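/- For a vector or matrix $V$ with nonnegative integer entries let $|V|$ denote the sum of its entries. For an integer $k\ge 0$ let $\omega(k)=k^k/k!$ (with $0^0=1$), and let $\Omega(V)=\prod_v \omega(v)$, the product over all entries $v$ of $V$. For $K=(k_{ij})\in\mathbb Z_{\ge0}^{m\times n}$, $R\in\mathbb Z_{\ge 0}^m$ and $C\in\mathbb Z_{\ge 0}^n$ let $T_K(R,C)$ be the number of matrices $A=(a_{ij})\in\mathbb Z_{\ge0}^{m\times n}$ with row sums $\sum_j a_{ij}=r_i$, column sums $\sum_i a_{ij}=c_j$, and $a_{ij}\le k_{ij}$ for all $i,j$. **Theorem.** Let $\alpha_1,\dots,\alpha_p\ge0$ with $\alpha_1+\cdots+\alpha_p=1$. Let $R^1,\dots,R^p\in\mathbb Z_{\ge0}^m$ and $C^1,\dots,C^p\in\mathbb Z_{\ge0}^n$ be such that $|R^1|=\cdots=|R^p|=|C^1|=\cdots=|C^p|=N$, and let $K=(k_{ij})\in\mathbb Z_{\ge0}^{m\times n}$. Suppose that $$R:=\sum_{t=1}^p\alpha_tR^t\qquad\text{and}\qquad C:=\sum_{t=1}^p\alpha_tC^t$$ have integer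 entries. Define $\tilde C^1,\dots,\tilde C^p,\tilde C$ by $$\tilde c^t_j:=\Big(\sum_{i=1}^m k_{ij}\Big)-c^t_j,\qquad \tilde c_j:=\Big(\sum_{i=1}^m k_{ij}\Big)-c_j\qquad(1\le t\le p,\ 1\le j\le n),$$ and suppose that all $\tilde c^t_j\ge 0$ (hence all $\tilde c_j\ge0$). Then $$\frac{\omega(|K|)\,T_K(R,C)}{\Omega(R)\,\Omega(\tilde C)\,\Omega(K)}\ \ge\ \prod_{t=1}^p\left[\frac{T_K(R^t,C^t)}{\min\{\Omega(R^t)\,\Omega(\tilde C^t),\ \Omega(K)\}}\right]^{\alpha_t},$$ where a factor with $\alpha_t=0$ is read as $1$. -/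

import Mathlib

namespace BoundedTables

/-- `ω(n) = n ^ n / n!`, with `ω(0) = 1`. -/
noncomputable def omega (n : ℕ) : ℝ := (n : ℝ) ^ n / (n.factorial : ℝ)

/-- `Ω(v) = ∏ ω(v_i)`, the product over all entries of the vector `v`. -/
noncomputable def vecOmega {ι : Type*} [Fintype ι] (v : ι → ℕ) : ℝ := ∏ i, omega (v i)

/-- `Ω(K) = ∏ ω(k_{ij})`, the product over all entries of the matrix `K`. -/
noncomputable def matOmega {m n : ℕ} (K : Matrix (Fin m) (Fin n) ℕ) : ℝ :=
  ∏ i, ∏ j, omega (K i j)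

/-- `|K|`, the sum of all entries of the matrix `K`. -/
def matSum {m n : ℕ} (K : Matrix (Fin m) (Fin n) ℕ) : ℕ := ∑ i, ∑ j, K i j

/-- The contingency tables with row margins `R` and column margins `C` that are bounded
entrywise by `K`. -/
def tables {m n : ℕ} (K : Matrix (Fin m) (Fin n) ℕ) (R : Fin m → ℕ) (C : Fin n → ℕ) :
    Set (Matrix (Fin m) (Fin n) ℕ) :=
  {A | (∀ i, ∑ j, A i j = R i) ∧ (∀ j, ∑ i, A i j = C j) ∧ ∀ i j, A i j ≤ K i j}

/-- The set of `K`-bounded tables is finite, so that its `Set.ncard` is its true size. -/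
theorem tables_finite {m n : ℕ} (K : Matrix (Fin m) (Fin n) ℕ) (R : Fin m → ℕ)
    (C : Fin n → ℕ) : (tables K R C).Finite := by
  have h : (Set.univ.pi fun i : Fin m => Set.univ.pi fun j : Fin n =>
      Set.Iic (K i j)).Finite :=
    Set.Finite.pi' (fun i => Set.Finite.pi' (fun j => Set.finite_Iic (K i j))) |>.subset
      (fun A hA i j => hA i (Set.mem_univ i) j (Set.mem_univ j))
  exact h.subset fun A hA i _ j _ => hA.2.2 i j

/-- `T_K(R, C)`, the number of `K`-bounded contingency tables with margins `R` and `C`. -/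
noncomputable def numTables {m n : ℕ} (K : Matrix (Fin m) (Fin n) ℕ) (R : Fin m → ℕ)
    (C : Fin n → ℕ) : ℕ := (tables K R C).ncard

/-- The complementary column margin `c̃_j = (∑ i, k_{ij}) - c_j`. It is only used for `C` with
`c_j ≤ ∑ i, k_{ij}`, where the subtraction of natural numbers is the subtraction of integers. -/
def compl {m n : ℕ} (K : Matrix (Fin m) (Fin n) ℕ) (C : Fin n → ℕ) : Fin n → ℕ :=
  fun j => (∑ i, K i j) - C j

end BoundedTables

/-!
A bounded table `A` together with its complement `K - A` is a table on the edges of a bipartite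
graph: the cell `(i, j)` is joined by one edge, carrying `A i j`, to its row and by another edge,
carrying `K i j - A i j`, to its column. The prescribed sums are `R` and `compl K C` at the rows
and columns and `K` at the cells. The number of such tables with margins `β` and `k` is the
integral over the positive orthant of `T(x) * exp (-∑ q, x q)`, where
`T(x) = ∑ a, ∏ q, x q ^ a q / (a q)!` is summed over these tables, so by the Prékopa–Leindler
inequality it suffices to show that `T` is log-concave, jointly in `x` and in the margin, up to
factors `Ω`.

For this, `T(x)` is compared with the infimum over positive `y` and `v` of
`(∑ q, x q * y (ℓ q) * v (κ q)) ^ D / (D ^ D * y ^ β * v ^ k)`, where `D` is the sum of the margins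
and the edge `q` joins the nodes `ℓ q` and `κ q`. The infimum is log-concave by the inequality of
arithmetic and geometric means. It is bounded below by `T(x) / Ω(β)` and by `T(x) / Ω(k)`, because
`T(x)` is the sum over some of the terms in a multinomial expansion. It is bounded above by
`ω(D) * T(x) / (Ω(β) * Ω(k))`, because `T(x)` is, up to factorials, the coefficient of `y ^ β` in a
product of linear forms, and Gurvits' capacity inequality bounds this coefficient from below: each
differentiation of a homogeneous stable polynomial costs a controlled factor of its capacity.
-/

namespace BoundedTables

section ArithGeomMean

theorem omega_pos (n : ℕ) : 0 < omega n := by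
  unfold omega
  rcases n.eq_zero_or_pos with rfl | hn
  · simp
  · positivity

theorem omega_div_omega_succ (n : ℕ) : omega n / omega (n + 1) = ((n : ℝ) / (n + 1)) ^ n := by
  rw [div_eq_iff (omega_pos _).ne']
  unfold omega
  rw [Nat.factorial_succ, div_pow]
  push_cast
  field_simp
  ring

theorem vecOmega_pos {ι : Type*} [Fintype ι] (v : ι → ℕ) : 0 < vecOmega v :=
  Finset.prod_pos fun i _ => omega_pos (v i)

theorem prod_pow_le_mean_pow {ι : Type*} (s : Finset ι) (r : ι → ℕ) (z : ι → ℝ)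
    (hz : ∀ i ∈ s, 0 ≤ z i) :
    ∏ i ∈ s, z i ^ r i ≤ ((∑ i ∈ s, r i * z i) / (∑ i ∈ s, r i : ℕ)) ^ ∑ i ∈ s, r i := by
  rcases (∑ i ∈ s, r i).eq_zero_or_pos with h0 | hpos
  · rw [h0, pow_zero]
    exact (Finset.prod_eq_one fun i hi => by rw [Finset.sum_eq_zero_iff.mp h0 i hi, pow_zero]).le
  have hmean := Real.geom_mean_le_arith_mean s (fun i => (r i : ℝ)) z
    (fun i _ => Nat.cast_nonneg _) (by exact_mod_cast hpos) hz
  simp only [Real.rpow_natCast, ← Nat.cast_sum] at hmean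
  have hprod : 0 ≤ ∏ i ∈ s, z i ^ r i := Finset.prod_nonneg fun i hi => pow_nonneg (hz i hi) _
  calc ∏ i ∈ s, z i ^ r i
      = ((∏ i ∈ s, z i ^ r i) ^ (((∑ i ∈ s, r i : ℕ) : ℝ))⁻¹) ^ ∑ i ∈ s, r i :=
        (Real.rpow_inv_natCast_pow hprod hpos.ne').symm
    _ ≤ _ := pow_le_pow_left₀ (by positivity) hmean _

theorem prod_pow_mul_sum_pow_le {ι : Type*} [Fintype ι] (r : ι → ℕ) (s : ι → ℝ)
    (hs : ∀ i, 0 ≤ s i) :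
    (∏ i, s i ^ r i) * ((∑ i, r i : ℕ) : ℝ) ^ (∑ i, r i) ≤
      (∏ i, (r i : ℝ) ^ r i) * (∑ i, s i) ^ (∑ i, r i) := by
  have hpow (x : ℝ) (l : ℕ) : x ^ l = (x / l) ^ l * (l : ℝ) ^ l := by
    rcases eq_or_ne l 0 with rfl | hl
    · simp
    · rw [← mul_pow, div_mul_cancel₀ x (Nat.cast_ne_zero.mpr hl)]
  have hmean := prod_pow_le_mean_pow Finset.univ r (fun i => s i / r i)
    fun i _ => div_nonneg (hs i) (Nat.cast_nonneg _)
  have hsum : ∑ i, (r i : ℝ) * (s i / r i) ≤ ∑ i, s i :=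
    Finset.sum_le_sum fun i _ => by
      rw [mul_div_left_comm]
      exact mul_le_of_le_one_right (hs i) (div_self_le_one _)
  calc (∏ i, s i ^ r i) * ((∑ i, r i : ℕ) : ℝ) ^ (∑ i, r i)
      = (∏ i, (r i : ℝ) ^ r i) *
          ((∏ i, (s i / r i) ^ r i) * ((∑ i, r i : ℕ) : ℝ) ^ (∑ i, r i)) := by
        rw [Finset.prod_congr rfl fun i _ => hpow (s i) (r i), Finset.prod_mul_distrib]
        ring
    _ ≤ (∏ i, (r i : ℝ) ^ r i) *
          (((∑ i, s i) / (∑ i, r i : ℕ)) ^ (∑ i, r i) * ((∑ i, r i : ℕ) : ℝ) ^ (∑ i, r i)) := by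
        refine mul_le_mul_of_nonneg_left (mul_le_mul_of_nonneg_right (hmean.trans ?_) ?_) ?_
        · have h0 : 0 ≤ ∑ i, (r i : ℝ) * (s i / r i) := Finset.sum_nonneg fun i _ =>
            mul_nonneg (Nat.cast_nonneg _) (div_nonneg (hs i) (Nat.cast_nonneg _))
          gcongr
        · positivity
        · positivity
    _ = _ := by rw [← hpow]

theorem succ_mul_mul_pow_le (e : ℕ) {s t : ℝ} (hs : 0 ≤ s) (ht : 0 ≤ t) :
    (e + 1) * t * s ^ e ≤ (s + t) ^ (e + 1) * (omega e / omega (e + 1)) := by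
  have h := prod_pow_mul_sum_pow_le ![e, 1] ![s, t] (by simp [Fin.forall_fin_two, hs, ht])
  simp only [Fin.prod_univ_two, Fin.sum_univ_two, Matrix.cons_val_zero, Matrix.cons_val_one,
    Nat.cast_add, Nat.cast_one, mul_one, pow_one] at h
  rw [omega_div_omega_succ, div_pow, mul_div_assoc', le_div_iff₀ (by positivity)]
  calc (e + 1) * t * s ^ e * ((e : ℝ) + 1) ^ e = s ^ e * t * ((e : ℝ) + 1) ^ (e + 1) := by ring
    _ ≤ (e : ℝ) ^ e * (s + t) ^ (e + 1) := h
    _ = (s + t) ^ (e + 1) * (e : ℝ) ^ e := mul_comm _ _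

theorem multiset_prod_le_mean_pow (A : Multiset ℝ) (hA : ∀ x ∈ A, 0 ≤ x) :
    A.prod ≤ (A.sum / A.card) ^ A.card := by
  classical
  have h := prod_pow_le_mean_pow A.toFinset (fun x => A.count x) id
    fun x hx => hA x (Multiset.mem_toFinset.mp hx)
  rw [Multiset.toFinset_sum_count_eq] at h
  simpa only [id, ← nsmul_eq_mul, ← Finset.prod_multiset_count, ← Finset.sum_multiset_count] using h

theorem multiset_prod_one_add_le {d : ℕ} (B : Multiset ℝ) (hB : ∀ b ∈ B, 0 ≤ b)
    (hcard : B.card ≤ d) : (B.map fun b => 1 + b).prod ≤ (1 + B.sum / d) ^ d := by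
  rcases d.eq_zero_or_pos with rfl | hd
  · simp [Multiset.card_eq_zero.mp (Nat.le_zero.mp hcard)]
  have h := multiset_prod_le_mean_pow
    (B.map (fun b => 1 + b) + Multiset.replicate (d - B.card) 1) fun x hx => by
      rcases Multiset.mem_add.mp hx with hx | hx
      · obtain ⟨b, hb, rfl⟩ := Multiset.mem_map.mp hx
        linarith [hB b hb]
      · rw [Multiset.eq_of_mem_replicate hx]
        exact zero_le_one
  have hsum : (B.map fun b => 1 + b).sum = B.card + B.sum := by
    rw [Multiset.sum_map_add, Multiset.map_id', Multiset.map_const', Multiset.sum_replicate,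
      nsmul_one]
  simp only [Multiset.prod_add, Multiset.prod_replicate, one_pow, mul_one, Multiset.sum_add, hsum,
    Multiset.sum_replicate, Multiset.card_add, Multiset.card_map, Multiset.card_replicate,
    Nat.add_sub_cancel' hcard, nsmul_eq_mul, Nat.cast_sub hcard] at h
  convert h using 2
  field_simp
  ring

end ArithGeomMean

section RealRooted

theorem mul_omega_ratio_le_of_forall_mul_le_pow {d : ℕ} {a S M : ℝ} (ha : 0 < a) (hS : 0 ≤ S)
    (h : ∀ t : ℝ, 0 < t → M * t ≤ a * (1 + t * S / (d + 1)) ^ (d + 1)) :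
    M * (omega d / omega (d + 1)) ≤ a * S := by
  rw [omega_div_omega_succ]
  rcases le_or_gt M 0 with hM | hM
  · exact (mul_nonpos_of_nonpos_of_nonneg hM (by positivity)).trans (by positivity)
  rcases hS.eq_or_lt with rfl | hS
  · have := h (2 * a / M) (by positivity)
    rw [mul_div_cancel₀ _ hM.ne'] at this
    simp at this
    linarith
  rcases Nat.eq_zero_or_pos d with rfl | hd
  · by_contra! hlt
    simp only [pow_zero, mul_one] at hlt
    have h1 := h (2 * a / (M - a * S)) (div_pos (by positivity) (by linarith))
    simp only [Nat.cast_zero, zero_add, div_one, pow_one] at h1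
    have h2 : (2 * a / (M - a * S)) * (M - a * S) = 2 * a := div_mul_cancel₀ _ (by linarith)
    linarith
  have h1 := h ((d + 1) / (d * S)) (by positivity)
  have h2 : 1 + ((d : ℝ) + 1) / (d * S) * S / (d + 1) = (d + 1) / d := by field_simp
  rw [h2, div_pow, mul_div_assoc', mul_div_assoc',
    div_le_div_iff₀ (by positivity) (by positivity)] at h1
  rw [div_pow, mul_div_assoc', div_le_iff₀ (by positivity)]
  have : 0 < (d : ℝ) * (d + 1) := by positivity
  refine le_of_mul_le_mul_right ?_ this
  calc _ = M * (d + 1) * d ^ (d + 1) := by ring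
    _ ≤ _ := h1
    _ = _ := by ring

theorem le_eval_derivative_of_splits {f : Polynomial ℝ} (hf : f.Splits) {d : ℕ}
    (hd : f.natDegree ≤ d + 1) {s M : ℝ} (hs : 0 < f.eval s) (hroots : ∀ x ∈ f.roots, x < s)
    (hM : ∀ t : ℝ, 0 < t → M * t ≤ f.eval (s + t)) :
    M * (omega d / omega (d + 1)) ≤ f.derivative.eval s := by
  have hgap : ∀ z ∈ f.roots, 0 < s - z := fun z hz => sub_pos.mpr (hroots z hz)
  rw [hf.eval_derivative_eq_eval_mul_sum hs.ne']
  refine mul_omega_ratio_le_of_forall_mul_le_pow hs ?_ fun t ht => (hM t ht).trans ?_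
  · refine Multiset.sum_nonneg fun b hb => ?_
    obtain ⟨z, hz, rfl⟩ := Multiset.mem_map.mp hb
    exact (one_div_pos.mpr (hgap z hz)).le
  have hfactor : f.eval (s + t) =
      f.eval s * ((f.roots.map fun z => t * (1 / (s - z))).map fun b => 1 + b).prod := by
    rw [hf.eval_eq_prod_roots, hf.eval_eq_prod_roots, mul_assoc, Multiset.map_map,
      ← Multiset.prod_map_mul]
    congr 2
    refine Multiset.map_congr rfl fun z hz => ?_
    have := (hgap z hz).ne'
    simp only [Function.comp]
    field_simp
    ring
  rw [hfactor, ← Multiset.sum_map_mul_left]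
  have hmean := multiset_prod_one_add_le (d := d + 1) (f.roots.map fun z => t * (1 / (s - z)))
    (fun b hb => by
      obtain ⟨z, hz, rfl⟩ := Multiset.mem_map.mp hb
      exact (mul_pos ht (one_div_pos.mpr (hgap z hz))).le)
    (by rw [Multiset.card_map]; exact (Polynomial.card_roots' f).trans hd)
  push_cast at hmean
  exact mul_le_mul_of_nonneg_left hmean hs.le

end RealRooted

section Stable

open MvPolynomial

variable {σ : Type*}

section Slice

variable [DecidableEq σ] {A S : Type*} [CommSemiring A] [CommSemiring S] [Algebra A S]

/-- The restriction of `p` to the line through `z` in the direction of the coordinate `j`, as a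
polynomial in that coordinate. -/
noncomputable def slice (p : MvPolynomial σ A) (z : σ → S) (j : σ) : Polynomial S :=
  aeval (Function.update (fun k => Polynomial.C (z k)) j Polynomial.X) p

theorem eval_slice (p : MvPolynomial σ A) (z : σ → S) (j : σ) (s : S) :
    (slice p z j).eval s = aeval (Function.update z j s) p := by
  unfold slice
  induction p using MvPolynomial.induction_on with
  | C a => simp [Polynomial.algebraMap_apply]
  | add p q hp hq => simp only [map_add, Polynomial.eval_add, hp, hq]
  | mul_X p k hp =>
    rw [map_mul, map_mul, Polynomial.eval_mul, hp, aeval_X, aeval_X]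
    obtain rfl | hk := eq_or_ne k j
    · simp
    · simp [hk]

theorem derivative_slice (p : MvPolynomial σ A) (z : σ → S) (j : σ) :
    (slice p z j).derivative = slice (pderiv j p) z j := by
  unfold slice
  induction p using MvPolynomial.induction_on with
  | C a => simp [Polynomial.algebraMap_apply]
  | add p q hp hq => simp only [map_add, hp, hq]
  | mul_X p k hp =>
    rw [map_mul, Polynomial.derivative_mul, hp, Derivation.leibniz, aeval_X]
    obtain rfl | hk := eq_or_ne k j
    · simp [mul_comm, add_comm]
    · simp [hk, pderiv_X_of_ne hk, mul_comm]

theorem map_slice (p : MvPolynomial σ A) (y : σ → A) (j : σ) :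
    (slice p y j).map (algebraMap A S) = slice p (fun k => algebraMap A S (y k)) j := by
  unfold slice
  induction p using MvPolynomial.induction_on with
  | C a => simp [Polynomial.algebraMap_apply]
  | add p q hp hq => simp only [map_add, Polynomial.map_add, hp, hq]
  | mul_X p k hp =>
    rw [map_mul, map_mul, Polynomial.map_mul, hp, aeval_X, aeval_X]
    obtain rfl | hk := eq_or_ne k j
    · simp
    · simp [hk]

theorem natDegree_slice_le {p : MvPolynomial σ A} {d : ℕ} (hp : p.IsHomogeneous d) (z : σ → A)
    (j : σ) : (slice p z j).natDegree ≤ d := by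
  have h := aeval_natDegree_le (m := d) (n := 1) p hp.totalDegree_le
    (Function.update (fun k => Polynomial.C (z k)) j Polynomial.X) fun k => by
      obtain rfl | hk := eq_or_ne k j
      · rw [Function.update_self]
        exact Polynomial.natDegree_X_le
      · rw [Function.update_of_ne hk, Polynomial.natDegree_C]
        exact zero_le_one
  rwa [mul_one] at h

end Slice

theorem aeval_smul_of_isHomogeneous {A S : Type*} [CommSemiring A] [CommSemiring S] [Algebra A S]
    {p : MvPolynomial σ A} {d : ℕ} (hp : p.IsHomogeneous d) (r : S) (z : σ → S) :
    aeval (r • z) p = r ^ d * aeval z p := by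
  rw [aeval_def, aeval_def, eval₂_eq, eval₂_eq, Finset.mul_sum]
  refine Finset.sum_congr rfl fun m hm => ?_
  have hdeg : ∑ i ∈ m.support, m i = d := by
    rw [← Finsupp.degree_apply, Finsupp.degree_eq_weight_one]
    exact hp (mem_support_iff.mp hm)
  simp only [Pi.smul_apply, smul_eq_mul, mul_pow, Finset.prod_mul_distrib,
    Finset.prod_pow_eq_pow_sum, hdeg]
  ring

/-- A real polynomial is strictly stable if it does not vanish at a point of the closed right
half-space unless all coordinates of the point are purely imaginary. For homogeneous polynomials
this is a strict form of stability with respect to the right half-plane. -/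
def StrictlyStable (p : MvPolynomial σ ℝ) : Prop :=
  ∀ z : σ → ℂ, (∀ j, 0 ≤ (z j).re) → (∃ j, 0 < (z j).re) → aeval z p ≠ 0

namespace StrictlyStable

variable {p : MvPolynomial σ ℝ} {d : ℕ}

theorem aeval_single_ne_zero [DecidableEq σ] (hs : StrictlyStable p) (j : σ) :
    aeval (Pi.single j (1 : ℂ)) p ≠ 0 := by
  refine hs _ (fun k => ?_) ⟨j, by simp⟩
  obtain rfl | hk := eq_or_ne k j
  · simp
  · simp [hk]

theorem natDegree_slice_pos [DecidableEq σ] (hs : StrictlyStable p)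
    (hp : p.IsHomogeneous (d + 1)) (z : σ → ℂ) (j : σ) : 0 < (slice p z j).natDegree := by
  by_contra! h0
  have hconst := Polynomial.eq_C_of_natDegree_le_zero h0
  set c := (slice p z j).coeff 0
  have hline (s : ℂ) : aeval (Function.update z j s) p = c := by
    rw [← eval_slice, hconst, Polynomial.eval_C]
  -- By homogeneity the constant value `c` on the line determines the values near `Pi.single j 1`.
  have hscaled : (fun r : ℂ => aeval (Function.update (r • z) j 1) p) =
      fun r : ℂ => r ^ (d + 1) * c := by
    refine Continuous.ext_on (dense_compl_singleton (0 : ℂ)) ?_ (by fun_prop) fun r hr => ?_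
    · simp_rw [aeval_def, ← eval_map]
      exact (continuous_eval _).comp (by fun_prop)
    · rw [← hline r⁻¹, ← aeval_smul_of_isHomogeneous hp, ← Function.update_smul, smul_eq_mul,
        mul_inv_cancel₀ hr]
  have hzero := congrFun hscaled 0
  rw [zero_pow d.succ_ne_zero, zero_mul, zero_smul] at hzero
  exact hs.aeval_single_ne_zero j hzero

theorem pderiv (hs : StrictlyStable p) (hp : p.IsHomogeneous (d + 1)) (j : σ) :
    StrictlyStable (pderiv j p) := by
  classical
  intro z hz ⟨i, hi⟩ h0
  set g := slice p z j
  have hdeg := hs.natDegree_slice_pos hp z j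
  have hcrit : z j ∈ g.derivative.rootSet ℂ := by
    rw [Polynomial.mem_rootSet, Polynomial.coe_aeval_eq_eval, derivative_slice, eval_slice,
      Function.update_eq_self, ← derivative_slice]
    exact ⟨fun h => hdeg.ne' (Polynomial.derivative_eq_zero.mp h), h0⟩
  have hroots : g.rootSet ℂ ⊆ {w | w.re < (z j).re} := by
    intro w hw
    rw [Polynomial.mem_rootSet, Polynomial.coe_aeval_eq_eval, eval_slice] at hw
    by_contra! hle
    have hle : (z j).re ≤ w.re := by simpa using hle
    have hmono (k : σ) : (z k).re ≤ (Function.update z j w k).re := by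
      obtain rfl | hk := eq_or_ne k j
      · simpa using hle
      · simp [hk]
    exact hs _ (fun k => (hz k).trans (hmono k)) ⟨i, hi.trans_le (hmono i)⟩ hw.2
  have hconv := Polynomial.rootSet_derivative_subset_convexHull_rootSet
    (Polynomial.natDegree_pos_iff_degree_pos.mp hdeg) hcrit
  have hlt : (z j).re < (z j).re := convexHull_min hroots (convex_halfSpace_re_lt _) hconv
  exact lt_irrefl _ hlt

theorem im_eq_zero_and_re_nonpos_of_eval_slice_eq_zero [DecidableEq σ] (hs : StrictlyStable p)
    (hp : p.IsHomogeneous d) {y : σ → ℝ} (hy : ∀ k, 0 < y k) (j : σ) {w : ℂ}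
    (hw : (slice p (fun k => (y k : ℂ)) j).eval w = 0) : w.im = 0 ∧ w.re ≤ 0 := by
  by_contra hcon
  have hpos : 0 < ‖w‖ + w.re := by
    by_contra! hle
    have habs : |w.re| = ‖w‖ := le_antisymm (Complex.abs_re_le_norm w) (by
      linarith [neg_abs_le w.re])
    exact hcon ⟨Complex.abs_re_eq_norm.mp habs, by linarith [norm_nonneg w]⟩
  have hw0 : 0 < ‖w‖ := norm_pos_iff.mpr fun h => by simp [h] at hpos
  -- `ζ` bisects the angle between `1` and `conj w`, so it turns both `1` and `w` into the open
  -- right half-plane.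
  set ζ : ℂ := (‖w‖ : ℂ) + (starRingEnd ℂ) w with hζ
  have hζre : ζ.re = ‖w‖ + w.re := by simp [hζ]
  have hζw : (ζ * w).re = ‖w‖ * (‖w‖ + w.re) := by
    rw [hζ, add_mul, mul_comm ((starRingEnd ℂ) w), Complex.mul_conj, Complex.normSq_eq_norm_sq,
      Complex.add_re, Complex.ofReal_re, Complex.re_ofReal_mul]
    ring
  have hall (k : σ) : 0 < ((ζ • Function.update (fun k => (y k : ℂ)) j w) k).re := by
    rw [Pi.smul_apply, smul_eq_mul]
    obtain rfl | hk := eq_or_ne k j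
    · rw [Function.update_self, hζw]
      positivity
    · rw [Function.update_of_ne hk, Complex.re_mul_ofReal, hζre]
      exact mul_pos hpos (hy k)
  refine hs _ (fun k => (hall k).le) ⟨j, hall j⟩ ?_
  rw [aeval_smul_of_isHomogeneous hp, ← eval_slice, hw, mul_zero]

theorem splits_slice [DecidableEq σ] (hs : StrictlyStable p) (hp : p.IsHomogeneous d)
    {y : σ → ℝ} (hy : ∀ k, 0 < y k) (j : σ) : (slice p y j).Splits := by
  refine Polynomial.Splits.of_splits_map (algebraMap ℝ ℂ) (IsAlgClosed.splits _) fun w hw => ?_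
  rw [map_slice] at hw
  have hreal := hs.im_eq_zero_and_re_nonpos_of_eval_slice_eq_zero hp hy j
    (Polynomial.isRoot_of_mem_roots hw)
  exact ⟨w.re, Complex.ext (by simp) (by simp [hreal.1])⟩

theorem roots_slice_nonpos [DecidableEq σ] (hs : StrictlyStable p) (hp : p.IsHomogeneous d)
    {y : σ → ℝ} (hy : ∀ k, 0 < y k) (j : σ) {x : ℝ} (hx : x ∈ (slice p y j).roots) : x ≤ 0 := by
  refine (hs.im_eq_zero_and_re_nonpos_of_eval_slice_eq_zero hp hy j (w := x) ?_).2
  have hroot := (Polynomial.isRoot_of_mem_roots hx).map (f := algebraMap ℝ ℂ)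
  rwa [map_slice] at hroot

end StrictlyStable

section Capacity

variable [Fintype σ]

/-- The number `c` is a lower bound for the capacity `inf_{y > 0} p(y) / y ^ β` of the polynomial
`p` at the exponent `β`. -/
def HasCapacityBound (p : MvPolynomial σ ℝ) (β : σ →₀ ℕ) (c : ℝ) : Prop :=
  ∀ y : σ → ℝ, (∀ j, 0 < y j) → c * ∏ j, y j ^ β j ≤ aeval y p

theorem prod_pow_add_single (y : σ → ℝ) (β : σ →₀ ℕ) (j : σ) :
    ∏ k, y k ^ (β + Finsupp.single j 1 : σ →₀ ℕ) k = (∏ k, y k ^ β k) * y j := by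
  classical
  simp only [Finsupp.add_apply, pow_add, Finset.prod_mul_distrib, Finsupp.single_apply,
    pow_ite, pow_one, pow_zero, Finset.prod_ite_eq, Finset.mem_univ, if_true]

theorem vecOmega_add_single (β : σ →₀ ℕ) (j : σ) :
    vecOmega ⇑(β + Finsupp.single j 1 : σ →₀ ℕ) =
      vecOmega ⇑β / (omega (β j) / omega (β j + 1)) := by
  classical
  unfold vecOmega
  rw [Fintype.prod_eq_mul_prod_compl j, Fintype.prod_eq_mul_prod_compl j, Finsupp.add_apply,
    Finsupp.single_eq_same]
  have hrest : ∏ k ∈ {j}ᶜ, omega ((β + Finsupp.single j 1 : σ →₀ ℕ) k) = ∏ k ∈ {j}ᶜ, omega (β k) :=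
    Finset.prod_congr rfl fun k hk => by
      rw [Finsupp.add_apply, Finsupp.single_eq_of_ne (by simpa using hk), add_zero]
  rw [hrest]
  have := (omega_pos (β j)).ne'
  field_simp

theorem StrictlyStable.hasCapacityBound_pderiv {p : MvPolynomial σ ℝ} {d : ℕ}
    (hs : StrictlyStable p) (hp : p.IsHomogeneous (d + 1)) {β : σ →₀ ℕ} {j : σ} {c : ℝ}
    (hc : 0 < c) (h : HasCapacityBound p (β + Finsupp.single j 1) c) :
    HasCapacityBound (MvPolynomial.pderiv j p) β
      (c * (β j + 1) / (omega (β j) / omega (β j + 1)) * (omega d / omega (d + 1))) := by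
  classical
  intro y hy
  set e := β j
  set Y := ∏ k ∈ {j}ᶜ, y k ^ β k
  have hY : 0 < Y := Finset.prod_pos fun k _ => pow_pos (hy k) _
  have hlow (s : ℝ) (hs' : 0 < s) : c * (s ^ (e + 1) * Y) ≤ (slice p y j).eval s := by
    rw [eval_slice]
    refine le_of_eq_of_le ?_ (h (Function.update y j s) fun k => ?_)
    · rw [prod_pow_add_single, Fintype.prod_eq_mul_prod_compl j, Function.update_self, pow_succ,
        Finset.prod_congr rfl fun k hk => by rw [Function.update_of_ne (by simpa using hk)]]
      ring
    · obtain rfl | hk := eq_or_ne k j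
      · simpa using hs'
      · simpa [hk] using hy k
  have hωe : 0 < omega e / omega (e + 1) := div_pos (omega_pos _) (omega_pos _)
  have hgrowth (t : ℝ) (ht : 0 < t) : c * (e + 1) / (omega e / omega (e + 1)) * (y j ^ e * Y) * t ≤
      (slice p y j).eval (y j + t) := by
    refine le_trans ?_ (hlow (y j + t) (add_pos (hy j) ht))
    rw [div_mul_eq_mul_div, div_mul_eq_mul_div, div_le_iff₀ hωe]
    calc _ = c * Y * ((e + 1) * t * y j ^ e) := by ring
      _ ≤ c * Y * ((y j + t) ^ (e + 1) * (omega e / omega (e + 1))) :=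
        mul_le_mul_of_nonneg_left (succ_mul_mul_pow_le e (hy j).le ht.le) (by positivity)
      _ = _ := by ring
  have hpos : 0 < (slice p y j).eval (y j) :=
    lt_of_lt_of_le (by have := hy j; positivity) (hlow _ (hy j))
  have hderiv := le_eval_derivative_of_splits (hs.splits_slice hp hy j)
    (natDegree_slice_le hp y j) hpos
    (fun x hx => (hs.roots_slice_nonpos hp hy j hx).trans_lt (hy j)) hgrowth
  rw [derivative_slice, eval_slice, Function.update_eq_self] at hderiv
  refine le_of_eq_of_le ?_ hderiv
  rw [Fintype.prod_eq_mul_prod_compl j]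
  ring

theorem StrictlyStable.le_coeff {p : MvPolynomial σ ℝ} {d : ℕ} (hs : StrictlyStable p)
    (hp : p.IsHomogeneous d) {β : σ →₀ ℕ} (hβ : ∑ j, β j = d) {c : ℝ} (hc : 0 < c)
    (h : HasCapacityBound p β c) : c * (vecOmega ⇑β / omega d) ≤ coeff β p := by
  classical
  induction d generalizing p β c with
  | zero =>
    obtain rfl : β = 0 := Finsupp.ext fun j => Finset.sum_eq_zero_iff.mp hβ j (Finset.mem_univ j)
    have hone := h (fun _ => 1) fun _ => one_pos
    rw [← totalDegree_zero_iff_isHomogeneous, totalDegree_eq_zero_iff_eq_C] at hp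
    rw [hp] at hone
    simpa [vecOmega, omega] using hone
  | succ d ih =>
    obtain ⟨j, -, hj⟩ := Finset.exists_ne_zero_of_sum_ne_zero (hβ.trans_ne d.succ_ne_zero)
    obtain ⟨β, rfl⟩ : ∃ β', β = β' + Finsupp.single j 1 :=
      ⟨β - Finsupp.single j 1, (tsub_add_cancel_of_le
        (Finsupp.single_le_iff.mpr (Nat.one_le_iff_ne_zero.mpr hj))).symm⟩
    have hβ' : ∑ k, β k = d := by
      simpa [Finset.sum_add_distrib, Finsupp.single_apply] using hβ
    have hωe : 0 < omega (β j) / omega (β j + 1) := div_pos (omega_pos _) (omega_pos _)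
    have hωd := omega_pos d
    have hωd' := omega_pos (d + 1)
    have hstep := ih (hs.pderiv hp j) hp.pderiv hβ' (by positivity)
      (hs.hasCapacityBound_pderiv hp hc h)
    rw [coeff_pderiv] at hstep
    rw [vecOmega_add_single, ← mul_le_mul_iff_left₀ (by positivity : (0 : ℝ) < β j + 1)]
    refine le_of_eq_of_le ?_ hstep
    field_simp

end Capacity

section LinearForms

variable {ι : Type*} [Fintype ι] [Fintype σ]

/-- The product of the powers `L i ^ k i` of the linear forms `L i` with coefficients `a i`. -/
noncomputable def prodLinearPow {A : Type*} [CommSemiring A] (a : ι → σ → A) (k : ι → ℕ) :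
    MvPolynomial σ A :=
  ∏ i, (∑ j, C (a i j) * X j) ^ k i

theorem aeval_prodLinearPow {A S : Type*} [CommSemiring A] [CommSemiring S] [Algebra A S]
    (a : ι → σ → A) (k : ι → ℕ) (z : σ → S) :
    aeval z (prodLinearPow a k) = ∏ i, (∑ j, algebraMap A S (a i j) * z j) ^ k i := by
  simp only [prodLinearPow, map_prod, map_pow, map_sum, map_mul, aeval_X, aeval_C]

theorem isHomogeneous_prodLinearPow {A : Type*} [CommSemiring A] (a : ι → σ → A) (k : ι → ℕ) :
    (prodLinearPow a k).IsHomogeneous (∑ i, k i) := by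
  refine IsHomogeneous.prod _ _ _ fun i _ => ?_
  have hlin : (∑ j, C (a i j) * X j).IsHomogeneous 1 := IsHomogeneous.sum _ _ _ fun j _ => by
    simpa using (isHomogeneous_C σ (a i j)).mul (isHomogeneous_X A j)
  simpa using hlin.pow (k i)

theorem strictlyStable_prodLinearPow {a : ι → σ → ℝ} (ha : ∀ i j, 0 < a i j) (k : ι → ℕ) :
    StrictlyStable (prodLinearPow a k) := by
  intro z hz ⟨j, hj⟩
  rw [aeval_prodLinearPow]
  refine Finset.prod_ne_zero_iff.mpr fun i _ => pow_ne_zero _ fun h0 => ?_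
  have hre := congrArg Complex.re h0
  simp only [Complex.re_sum, Complex.coe_algebraMap, Complex.re_ofReal_mul, Complex.zero_re] at hre
  exact (Finset.sum_pos' (fun j _ => mul_nonneg (ha i j).le (hz j))
    ⟨j, Finset.mem_univ j, mul_pos (ha i j) hj⟩).ne' hre

theorem continuous_coeff_prodLinearPow_add (a : ι → σ → ℝ) (k : ι → ℕ) (β : σ →₀ ℕ) :
    Continuous fun ε : ℝ => coeff β (prodLinearPow (fun i j => a i j + ε) k) := by
  -- The coefficient is a polynomial in `ε`, namely the one of the product over `ℝ[ε]`.
  let q : Polynomial ℝ :=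
    coeff β (prodLinearPow (fun i j => Polynomial.C (a i j) + Polynomial.X) k)
  have hq : (fun ε : ℝ => coeff β (prodLinearPow (fun i j => a i j + ε) k)) =
      fun ε => q.eval ε := by
    funext ε
    rw [← Polynomial.coe_evalRingHom, ← coeff_map]
    simp [prodLinearPow]
  rw [hq]
  exact q.continuous

/-- A form of the lower bounds of van der Waerden type of Falikman, Egorychev and Gurvits. -/
theorem le_coeff_prodLinearPow {a : ι → σ → ℝ} (ha : ∀ i j, 0 ≤ a i j) {k : ι → ℕ} {β : σ →₀ ℕ}
    (hβ : ∑ j, β j = ∑ i, k i) {c : ℝ} (hc : 0 < c)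
    (h : HasCapacityBound (prodLinearPow a k) β c) :
    c * (vecOmega ⇑β / omega (∑ i, k i)) ≤ coeff β (prodLinearPow a k) := by
  have hpert (ε : ℝ) (hε : ε ∈ Set.Ioi 0) : c * (vecOmega ⇑β / omega (∑ i, k i)) ≤
      coeff β (prodLinearPow (fun i j => a i j + ε) k) := by
    have hε : 0 < ε := hε
    refine (strictlyStable_prodLinearPow (fun i j => add_pos_of_nonneg_of_pos (ha i j) hε)
      k).le_coeff (isHomogeneous_prodLinearPow _ k) hβ hc fun y hy => (h y hy).trans ?_
    rw [aeval_prodLinearPow, aeval_prodLinearPow]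
    have hy' (j : σ) : 0 ≤ y j := (hy j).le
    have ha' (i : ι) : 0 ≤ ∑ j, a i j * y j :=
      Finset.sum_nonneg fun j _ => mul_nonneg (ha i j) (hy' j)
    refine Finset.prod_le_prod (fun i _ => pow_nonneg (ha' i) _) fun i _ =>
      pow_le_pow_left₀ (ha' i) (Finset.sum_le_sum fun j _ =>
        mul_le_mul_of_nonneg_right ?_ (hy' j)) _
    exact le_add_of_nonneg_right hε.le
  have hlim := ge_of_tendsto
    ((continuous_coeff_prodLinearPow_add a k β).continuousWithinAt (s := Set.Ioi 0) (x := 0))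
    (Filter.eventually_of_mem self_mem_nhdsWithin hpert)
  simpa only [add_zero] using hlim

end LinearForms

end Stable

section BrunnMinkowski

open MeasureTheory
open scoped ENNReal Pointwise

theorem volume_add_volume_le_of_isCompact {A B : Set ℝ} (hA : IsCompact A) (hB : IsCompact B)
    (hA' : A.Nonempty) (hB' : B.Nonempty) : volume A + volume B ≤ volume (A + B) := by
  have ha := hA.sSup_mem hA'
  have hb := hB.sInf_mem hB'
  set a := sSup A
  set b := sInf B
  -- The translates `b + A` and `a + B` lie in `A + B` and meet only in `a + b`.
  have hdisj : AEDisjoint volume ((b + ·) '' A) ((a + ·) '' B) := by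
    refine measure_mono_null (t := {a + b}) ?_ (measure_singleton _)
    rintro _ ⟨⟨y, hy, rfl⟩, z, hz, hyz⟩
    have hya : y ≤ a := le_csSup hA.bddAbove hy
    have hbz : b ≤ z := csInf_le hB.bddBelow hz
    change a + z = b + y at hyz
    rw [Set.mem_singleton_iff]
    linarith
  have hmeas : MeasurableSet ((a + ·) '' B) :=
    (hB.image (continuous_const.add continuous_id)).measurableSet
  have hsub : (b + ·) '' A ∪ (a + ·) '' B ⊆ A + B := by
    rintro _ (⟨y, hy, rfl⟩ | ⟨z, hz, rfl⟩)
    · exact ⟨y, hy, b, hb, add_comm y b⟩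
    · exact ⟨a, ha, z, hz, rfl⟩
  calc volume A + volume B = volume ((b + ·) '' A) + volume ((a + ·) '' B) := by
        simp only [Set.image_add_left, measure_preimage_add]
    _ = volume ((b + ·) '' A ∪ (a + ·) '' B) :=
        (measure_union₀ hmeas.nullMeasurableSet hdisj).symm
    _ ≤ volume (A + B) := measure_mono hsub

variable {τ : Type*}

theorem sum_volume_le_of_isCompact (s : Finset τ) {A : τ → Set ℝ} (hA : ∀ t, IsCompact (A t))
    (hA' : ∀ t, (A t).Nonempty) : ∑ t ∈ s, volume (A t) ≤ volume (∑ t ∈ s, A t) := by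
  classical
  induction s using Finset.induction_on with
  | empty => simp
  | insert t s hts ih =>
    have hsum : IsCompact (∑ t ∈ s, A t) ∧ (∑ t ∈ s, A t).Nonempty :=
      Finset.sum_induction A (fun S => IsCompact S ∧ S.Nonempty)
        (fun _ _ hS hT => ⟨hS.1.add hT.1, hS.2.add hT.2⟩)
        ⟨isCompact_singleton, Set.singleton_nonempty 0⟩ fun t _ => ⟨hA t, hA' t⟩
    rw [Finset.sum_insert hts, Finset.sum_insert hts]
    exact (add_le_add_right ih _).trans
      (volume_add_volume_le_of_isCompact (hA t) hsum.1 (hA' t) hsum.2)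

theorem exists_seq_isCompact_tendsto_volume {A : Set ℝ} (hA : MeasurableSet A)
    (hA' : A.Nonempty) : ∃ K : ℕ → Set ℝ, (∀ n, IsCompact (K n) ∧ (K n).Nonempty ∧ K n ⊆ A) ∧
      Filter.Tendsto (fun n => volume (K n)) Filter.atTop (nhds (volume A)) := by
  set T : Set ℝ≥0∞ := {v | ∃ K, (IsCompact K ∧ K.Nonempty ∧ K ⊆ A) ∧ volume K = v}
  obtain ⟨x, hx⟩ := hA'
  have hsup : sSup T = volume A := by
    refine le_antisymm (sSup_le ?_) ?_
    · rintro _ ⟨K, ⟨-, -, hK⟩, rfl⟩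
      exact measure_mono hK
    · rw [hA.measure_eq_iSup_isCompact]
      refine iSup₂_le fun K hK => iSup_le fun hKc => ?_
      exact (measure_mono (Set.subset_insert x K)).trans (le_sSup ⟨insert x K,
        ⟨hKc.insert x, Set.insert_nonempty _ _, Set.insert_subset hx hK⟩, rfl⟩)
  obtain ⟨v, -, hv, hvT⟩ := exists_seq_tendsto_sSup (S := T)
    ⟨_, {x}, ⟨isCompact_singleton, Set.singleton_nonempty x, by simpa using hx⟩, rfl⟩
    (OrderTop.bddAbove T)
  choose K hK hKv using hvT
  exact ⟨K, hK, hsup ▸ hv.congr fun n => (hKv n).symm⟩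

theorem sum_mul_volume_le [Fintype τ] {α : τ → ℝ} (hα : ∀ t, 0 ≤ α t) {A : τ → Set ℝ}
    (hA : ∀ t, MeasurableSet (A t)) (hA' : ∀ t, (A t).Nonempty) :
    ∑ t, ENNReal.ofReal (α t) * volume (A t) ≤ volume (∑ t, α t • A t) := by
  choose K hK hKlim using fun t => exists_seq_isCompact_tendsto_volume (hA t) (hA' t)
  have hlim : Filter.Tendsto (fun n => ∑ t, ENNReal.ofReal (α t) * volume (K t n)) Filter.atTop
      (nhds (∑ t, ENNReal.ofReal (α t) * volume (A t))) := tendsto_finsetSum _ fun t _ =>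
    ENNReal.Tendsto.const_mul (hKlim t) (Or.inr ENNReal.ofReal_ne_top)
  refine le_of_tendsto' hlim fun n => ?_
  calc ∑ t, ENNReal.ofReal (α t) * volume (K t n) = ∑ t, volume (α t • K t n) :=
        Finset.sum_congr rfl fun t _ => by
          rw [Measure.addHaar_smul, Module.finrank_self, pow_one, abs_of_nonneg (hα t)]
    _ ≤ volume (∑ t, α t • K t n) := sum_volume_le_of_isCompact _
        (fun t => (hK t n).1.smul (α t)) fun t => (hK t n).2.1.smul_set
    _ ≤ volume (∑ t, α t • A t) := measure_mono <| Set.finsetSum_subset_finsetSum _ _ _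
        fun t _ => Set.smul_set_mono (hK t n).2.2

end BrunnMinkowski

section PrekopaLeindler

open MeasureTheory
open scoped ENNReal Pointwise

variable {τ : Type*}

theorem tendsto_finsetProd_of_ne_zero {X : Type*} {l : Filter X} (s : Finset τ)
    {u : τ → X → ℝ≥0∞} {v : τ → ℝ≥0∞} (hu : ∀ t, Filter.Tendsto (u t) l (nhds (v t)))
    (hv : ∀ t, v t ≠ 0) :
    Filter.Tendsto (fun n => ∏ t ∈ s, u t n) l (nhds (∏ t ∈ s, v t)) := by
  classical
  induction s using Finset.induction_on with
  | empty => simpa using tendsto_const_nhds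
  | insert t s hts ih =>
    simp only [Finset.prod_insert hts]
    exact ENNReal.Tendsto.mul (hu t) (Or.inl (hv t)) ih
      (Or.inl (Finset.prod_ne_zero_iff.mpr fun t _ => hv t))

theorem ennreal_rpow_sum_of_nonneg {α : τ → ℝ} (s : Finset τ) (hα : ∀ t ∈ s, 0 ≤ α t)
    (x : ℝ≥0∞) : x ^ ∑ t ∈ s, α t = ∏ t ∈ s, x ^ α t := by
  classical
  induction s using Finset.induction_on with
  | empty => simp
  | insert t s hts ih =>
    rw [Finset.forall_mem_insert] at hα
    rw [Finset.prod_insert hts, Finset.sum_insert hts, ← ih hα.2,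
      ENNReal.rpow_add_of_nonneg _ _ hα.1 (Finset.sum_nonneg hα.2)]

variable [Fintype τ] {α : τ → ℝ}

theorem prod_mul_rpow (hα : ∀ t, 0 ≤ α t) (x y : τ → ℝ≥0∞) :
    ∏ t, (x t * y t) ^ α t = (∏ t, x t ^ α t) * ∏ t, y t ^ α t := by
  rw [← Finset.prod_mul_distrib]
  exact Finset.prod_congr rfl fun t _ => ENNReal.mul_rpow_of_nonneg _ _ (hα t)

theorem prod_rpow_eq_self (hα : ∀ t, 0 ≤ α t) (hα1 : ∑ t, α t = 1) (x : ℝ≥0∞) :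
    ∏ t, x ^ α t = x := by
  rw [← ennreal_rpow_sum_of_nonneg _ fun t _ => hα t, hα1, ENNReal.rpow_one]

theorem ennreal_geom_mean_le_arith_mean (hα : ∀ t, 0 < α t) (hα1 : ∑ t, α t = 1)
    (x : τ → ℝ≥0∞) : ∏ t, x t ^ α t ≤ ∑ t, ENNReal.ofReal (α t) * x t := by
  by_cases hx : ∃ t, x t = ∞
  · obtain ⟨t, ht⟩ := hx
    have htop : ∑ t, ENNReal.ofReal (α t) * x t = ∞ := ENNReal.sum_eq_top.mpr ⟨t,
      Finset.mem_univ t, by rw [ht, ENNReal.mul_top (ENNReal.ofReal_pos.mpr (hα t)).ne']⟩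
    exact htop ▸ le_top
  · push Not at hx
    lift x to τ → NNReal using hx
    have hmean : ((∏ t, x t ^ ((α t).toNNReal : ℝ) : NNReal) : ℝ≥0∞) ≤
        ((∑ t, (α t).toNNReal * x t : NNReal) : ℝ≥0∞) :=
      ENNReal.coe_le_coe.mpr <| NNReal.geom_mean_le_arith_mean_weighted _ _ _ <| by
        rw [← Real.toNNReal_sum_of_nonneg fun t _ => (hα t).le, hα1, Real.toNNReal_one]
    push_cast at hmean
    refine le_of_eq_of_le (Finset.prod_congr rfl fun t _ => ?_) hmean
    rw [ENNReal.coe_rpow_of_nonneg _ (by positivity), Real.coe_toNNReal _ (hα t).le]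

section LayerCake

variable {X : Type*} [MeasurableSpace X] {f : X → ℝ≥0∞}

theorem lintegral_eq_lintegral_meas_ofReal_lt (μ : Measure X) (hf : Measurable f)
    (hfin : ∀ x, f x ≠ ∞) :
    ∫⁻ x, f x ∂μ = ∫⁻ r in Set.Ioi (0 : ℝ), μ {x | ENNReal.ofReal r < f x} := by
  calc ∫⁻ x, f x ∂μ = ∫⁻ x, ENNReal.ofReal (f x).toReal ∂μ :=
        lintegral_congr fun x => (ENNReal.ofReal_toReal (hfin x)).symm
    _ = ∫⁻ r in Set.Ioi (0 : ℝ), μ {x | r < (f x).toReal} :=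
        lintegral_eq_lintegral_meas_lt μ (.of_forall fun x => ENNReal.toReal_nonneg)
          hf.ennreal_toReal.aemeasurable
    _ = _ := setLIntegral_congr_fun measurableSet_Ioi fun r (hr : 0 < r) => by
        simp only [ENNReal.ofReal_lt_iff_lt_toReal hr.le (hfin _)]

theorem lintegral_eq_lintegral_meas_ofReal_le (μ : Measure X) (hf : Measurable f)
    (hfin : ∀ x, f x ≠ ∞) :
    ∫⁻ x, f x ∂μ = ∫⁻ r in Set.Ioi (0 : ℝ), μ {x | ENNReal.ofReal r ≤ f x} := by
  calc ∫⁻ x, f x ∂μ = ∫⁻ x, ENNReal.ofReal (f x).toReal ∂μ :=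
        lintegral_congr fun x => (ENNReal.ofReal_toReal (hfin x)).symm
    _ = ∫⁻ r in Set.Ioi (0 : ℝ), μ {x | r ≤ (f x).toReal} :=
        lintegral_eq_lintegral_meas_le μ (.of_forall fun x => ENNReal.toReal_nonneg)
          hf.ennreal_toReal.aemeasurable
    _ = _ := lintegral_congr fun r => by simp only [ENNReal.ofReal_le_iff_le_toReal (hfin _)]

end LayerCake

/-- The measure `μ` satisfies the Prékopa–Leindler inequality with weights `α`, stated for lower
integrals so that no integrability is involved. -/
def HasPrekopaLeindler {E : Type*} [AddCommGroup E] [Module ℝ E] [MeasurableSpace E]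
    (α : τ → ℝ) (μ : Measure E) : Prop :=
  ∀ (f : τ → E → ℝ≥0∞) (h : E → ℝ≥0∞), (∀ t, Measurable (f t)) → Measurable h →
    (∀ x : τ → E, ∏ t, f t (x t) ^ α t ≤ h (∑ t, α t • x t)) →
    ∏ t, (∫⁻ x, f t x ∂μ) ^ α t ≤ ∫⁻ x, h x ∂μ

theorem sum_mul_volume_superlevel_le (hα : ∀ t, 0 ≤ α t) (hα1 : ∑ t, α t = 1)
    {g : τ → ℝ → ℝ≥0∞} {h : ℝ → ℝ≥0∞} (hg : ∀ t, Measurable (g t))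
    (hgh : ∀ x : τ → ℝ, ∏ t, g t (x t) ^ α t ≤ h (∑ t, α t • x t)) {r : ℝ≥0∞}
    (hr : ∀ t, r < ⨆ x, g t x) :
    ∑ t, ENNReal.ofReal (α t) * volume {x | r < g t x} ≤ volume {x | r ≤ h x} := by
  refine (sum_mul_volume_le hα (fun t => measurableSet_lt measurable_const (hg t))
    fun t => lt_iSup_iff.mp (hr t)).trans (measure_mono fun x hx => ?_)
  obtain ⟨y, hy, rfl⟩ := (Set.mem_fintype_sum _ _).mp hx
  choose a ha hay using hy
  obtain rfl : (fun t => α t • a t) = y := funext hay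
  calc r = ∏ t, r ^ α t := (prod_rpow_eq_self hα hα1 r).symm
    _ ≤ ∏ t, g t (a t) ^ α t :=
        Finset.prod_le_prod' fun t _ => ENNReal.rpow_le_rpow (ha t).le (hα t)
    _ ≤ h (∑ t, α t • a t) := hgh a

theorem prekopaLeindler_of_iSup_eq_one (hα : ∀ t, 0 < α t) (hα1 : ∑ t, α t = 1)
    {g : τ → ℝ → ℝ≥0∞} {h : ℝ → ℝ≥0∞} (hg : ∀ t, Measurable (g t)) (hh : Measurable h)
    (hsup : ∀ t, ⨆ x, g t x = 1)
    (hgh : ∀ x : τ → ℝ, ∏ t, g t (x t) ^ α t ≤ h (∑ t, α t • x t)) :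
    ∏ t, (∫⁻ x, g t x) ^ α t ≤ ∫⁻ x, h x := by
  have hg1 (t : τ) (x : ℝ) : g t x ≤ 1 := (le_iSup (g t) x).trans (hsup t).le
  have hgt (t : τ) (x : ℝ) : g t x ≠ ∞ := ne_top_of_le_ne_top ENNReal.one_ne_top (hg1 t x)
  -- Truncating `h` at `1` makes the layer-cake formula applicable.
  have hgh' (x : τ → ℝ) : ∏ t, g t (x t) ^ α t ≤ min (h (∑ t, α t • x t)) 1 :=
    le_min (hgh x) (Finset.prod_le_one' fun t _ => ENNReal.rpow_le_one (hg1 t _) (hα t).le)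
  have hmeas (t : τ) : Measurable fun r : ℝ => volume {x | ENNReal.ofReal r < g t x} :=
    Antitone.measurable fun r s hrs => measure_mono fun x (hx : _ < _) =>
      (ENNReal.ofReal_le_ofReal hrs).trans_lt hx
  have hlevel (r : ℝ) : ∑ t, ENNReal.ofReal (α t) * volume {x | ENNReal.ofReal r < g t x} ≤
      volume {x | ENNReal.ofReal r ≤ min (h x) 1} := by
    rcases lt_or_ge r 1 with hr | hr
    · exact sum_mul_volume_superlevel_le (h := fun x => min (h x) 1) (fun t => (hα t).le) hα1 hg
        hgh' fun t => by rwa [hsup, ENNReal.ofReal_lt_one]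
    · have hempty (t : τ) : {x | ENNReal.ofReal r < g t x} = ∅ :=
        Set.eq_empty_of_forall_notMem fun x (hx : _ < _) =>
          (hx.trans_le (hg1 t x)).not_ge (ENNReal.one_le_ofReal.mpr hr)
      simp [hempty]
  calc ∏ t, (∫⁻ x, g t x) ^ α t ≤ ∑ t, ENNReal.ofReal (α t) * ∫⁻ x, g t x :=
        ennreal_geom_mean_le_arith_mean hα hα1 _
    _ = ∫⁻ r in Set.Ioi (0 : ℝ),
          ∑ t, ENNReal.ofReal (α t) * volume {x | ENNReal.ofReal r < g t x} := by
        rw [lintegral_finsetSum _ fun t _ => (hmeas t).const_mul _]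
        simp only [lintegral_const_mul _ (hmeas _),
          lintegral_eq_lintegral_meas_ofReal_lt volume (hg _) (hgt _)]
    _ ≤ ∫⁻ r in Set.Ioi (0 : ℝ), volume {x | ENNReal.ofReal r ≤ min (h x) 1} :=
        lintegral_mono hlevel
    _ = ∫⁻ x, min (h x) 1 := (lintegral_eq_lintegral_meas_ofReal_le volume
        (hh.min measurable_const) fun x => ne_top_of_le_ne_top ENNReal.one_ne_top
          (min_le_right _ _)).symm
    _ ≤ ∫⁻ x, h x := lintegral_mono fun x => min_le_left _ _

theorem prekopaLeindler_of_iSup_ne_top (hα : ∀ t, 0 < α t) (hα1 : ∑ t, α t = 1)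
    {f : τ → ℝ → ℝ≥0∞} {h : ℝ → ℝ≥0∞} (hf : ∀ t, Measurable (f t)) (hh : Measurable h)
    (hsup : ∀ t, ⨆ x, f t x ≠ ∞)
    (hfh : ∀ x : τ → ℝ, ∏ t, f t (x t) ^ α t ≤ h (∑ t, α t • x t)) :
    ∏ t, (∫⁻ x, f t x) ^ α t ≤ ∫⁻ x, h x := by
  set M : τ → ℝ≥0∞ := fun t => ⨆ x, f t x
  by_cases h0 : ∃ t, M t = 0
  · obtain ⟨t, ht⟩ := h0
    have hzero (x : ℝ) : f t x = 0 := le_antisymm ((le_iSup (f t) x).trans ht.le) zero_le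
    rw [Finset.prod_eq_zero (Finset.mem_univ t) (by simp [hzero, hα t])]
    exact zero_le
  push Not at h0
  have hα' (t : τ) : 0 ≤ α t := (hα t).le
  set m := ∏ t, M t ^ α t
  have hm0 : m ≠ 0 := Finset.prod_ne_zero_iff.mpr fun t _ => by
    simp [ENNReal.rpow_eq_zero_iff, h0 t, hα' t]
  have hmt : m ≠ ∞ := ENNReal.prod_ne_top fun t _ =>
    ENNReal.rpow_ne_top_of_nonneg (hα' t) (hsup t)
  have hscale (y : τ → ℝ≥0∞) : m * ∏ t, ((M t)⁻¹ * y t) ^ α t = ∏ t, y t ^ α t := by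
    rw [← prod_mul_rpow hα']
    simp only [← mul_assoc, ENNReal.mul_inv_cancel (h0 _) (hsup _), one_mul]
  have hnormalized := prekopaLeindler_of_iSup_eq_one hα hα1 (g := fun t x => (M t)⁻¹ * f t x)
    (h := fun x => m⁻¹ * h x) (fun t => (hf t).const_mul _) (hh.const_mul _)
    (fun t => by rw [← ENNReal.mul_iSup, ENNReal.inv_mul_cancel (h0 t) (hsup t)])
    fun x => by
      rw [← ENNReal.mul_le_iff_le_inv hm0 hmt, hscale]
      exact hfh x
  simp only [lintegral_const_mul _ hh, lintegral_const_mul _ (hf _)] at hnormalized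
  rwa [← ENNReal.mul_le_iff_le_inv hm0 hmt, hscale] at hnormalized

theorem hasPrekopaLeindler_real (hα : ∀ t, 0 < α t) (hα1 : ∑ t, α t = 1) :
    HasPrekopaLeindler α (volume : Measure ℝ) := by
  intro f h hf hh hfh
  by_cases h0 : ∃ t, ∫⁻ x, f t x = 0
  · obtain ⟨t, ht⟩ := h0
    rw [Finset.prod_eq_zero (Finset.mem_univ t) (by simp [ht, hα t])]
    exact zero_le
  push Not at h0
  have htrunc (t : τ) : Filter.Tendsto (fun n : ℕ => ∫⁻ x, min (f t x) n) Filter.atTop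
      (nhds (∫⁻ x, f t x)) :=
    lintegral_tendsto_of_tendsto_of_monotone
      (fun n => ((hf t).min measurable_const).aemeasurable)
      (.of_forall fun x m n hmn => min_le_min_left _ (Nat.cast_le.mpr hmn))
      (.of_forall fun x => by
        simpa using (tendsto_const_nhds (x := f t x)).min ENNReal.tendsto_nat_nhds_top)
  have hlim := tendsto_finsetProd_of_ne_zero Finset.univ
    (fun t => (htrunc t).ennrpow_const (α t)) fun t => by
      simp [ENNReal.rpow_eq_zero_iff, h0 t, (hα t).not_gt]
  refine le_of_tendsto' hlim fun n => prekopaLeindler_of_iSup_ne_top hα hα1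
    (fun t => (hf t).min measurable_const) hh (fun t => ?_) fun x => ?_
  · exact ne_top_of_le_ne_top (ENNReal.natCast_ne_top n) (iSup_le fun x => min_le_right _ _)
  · exact (Finset.prod_le_prod' fun t _ =>
      ENNReal.rpow_le_rpow (min_le_left _ _) (hα t).le).trans (hfh x)

namespace HasPrekopaLeindler

variable {E F : Type*} [AddCommGroup E] [Module ℝ E] [MeasurableSpace E] [AddCommGroup F]
  [Module ℝ F] [MeasurableSpace F] {μ : Measure E} {ν : Measure F}

theorem prod [SFinite ν] (hμ : HasPrekopaLeindler α μ) (hν : HasPrekopaLeindler α ν) :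
    HasPrekopaLeindler α (μ.prod ν) := by
  intro f h hf hh hfh
  simp_rw [lintegral_prod _ (hf _).aemeasurable, lintegral_prod _ hh.aemeasurable]
  refine hμ _ _ (fun t => (hf t).lintegral_prod_right') hh.lintegral_prod_right' fun x => ?_
  refine hν _ _ (fun t => (hf t).comp measurable_prodMk_left) (hh.comp measurable_prodMk_left)
    fun y => (hfh fun t => (x t, y t)).trans_eq (congrArg h (Prod.ext ?_ ?_))
  · simp [Prod.fst_sum]
  · simp [Prod.snd_sum]

theorem of_measurePreserving (hμ : HasPrekopaLeindler α μ) (e : E →ₗ[ℝ] F)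
    (he : MeasurePreserving e μ ν) : HasPrekopaLeindler α ν := by
  intro f h hf hh hfh
  simp_rw [← he.lintegral_comp (hf _), ← he.lintegral_comp hh]
  refine hμ _ _ (fun t => (hf t).comp he.measurable) (hh.comp he.measurable) fun x => ?_
  simpa only [Function.comp_apply, map_sum, map_smul] using hfh fun t => e (x t)

theorem prod_integral_rpow_le (hμ : HasPrekopaLeindler α μ) (hα : ∀ t, 0 ≤ α t)
    {f : τ → E → ℝ} (hfm : ∀ t, Measurable (f t)) (hfi : ∀ t, Integrable (f t) μ)
    (hf : ∀ t, 0 ≤ f t) {h : E → ℝ} (hhm : Measurable h) (hhi : Integrable h μ) (hh : 0 ≤ h)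
    (hle : ∀ x : τ → E, ∏ t, f t (x t) ^ α t ≤ h (∑ t, α t • x t)) :
    ∏ t, (∫ x, f t x ∂μ) ^ α t ≤ ∫ x, h x ∂μ := by
  have hint (t : τ) : 0 ≤ ∫ x, f t x ∂μ := integral_nonneg (hf t)
  have hlint := hμ (fun t x => ENNReal.ofReal (f t x)) (fun x => ENNReal.ofReal (h x))
    (fun t => (hfm t).ennreal_ofReal) hhm.ennreal_ofReal fun x => by
      simp only [ENNReal.ofReal_rpow_of_nonneg (hf _ _) (hα _)]
      rw [← ENNReal.ofReal_prod_of_nonneg fun t _ => Real.rpow_nonneg (hf t _) _]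
      exact ENNReal.ofReal_le_ofReal (hle x)
  simp only [← ofReal_integral_eq_lintegral_ofReal (hfi _) (ae_of_all _ (hf _)),
    ← ofReal_integral_eq_lintegral_ofReal hhi (ae_of_all _ hh),
    ENNReal.ofReal_rpow_of_nonneg (hint _) (hα _)] at hlint
  rwa [← ENNReal.ofReal_prod_of_nonneg fun t _ => Real.rpow_nonneg (hint t) _,
    ENNReal.ofReal_le_ofReal_iff (integral_nonneg hh)] at hlint

end HasPrekopaLeindler

theorem hasPrekopaLeindler_pi_fin (hα : ∀ t, 0 < α t) (hα1 : ∑ t, α t = 1) (n : ℕ) :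
    HasPrekopaLeindler α (volume : Measure (Fin n → ℝ)) := by
  induction n with
  | zero =>
    intro f h hf hh hfh
    simp_rw [Measure.volume_pi_eq_dirac (0 : Fin 0 → ℝ), lintegral_dirac' _ (hf _),
      lintegral_dirac' _ hh]
    simpa using hfh 0
  | succ n ih =>
    refine ((hasPrekopaLeindler_real hα hα1).prod ih).of_measurePreserving
      (Fin.consLinearEquiv ℝ fun _ : Fin (n + 1) => ℝ).toLinearMap ?_
    have hcons : ⇑(Fin.consLinearEquiv ℝ fun _ : Fin (n + 1) => ℝ).toLinearMap =
        (MeasurableEquiv.piFinSuccAbove (fun _ => ℝ) 0).symm := by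
      funext x
      simp [MeasurableEquiv.piFinSuccAbove, Fin.insertNthEquiv]
      rfl
    exact hcons ▸ (volume_preserving_piFinSuccAbove (fun _ : Fin (n + 1) => ℝ) 0).symm

theorem hasPrekopaLeindler_pi {ι : Type*} [Fintype ι] (hα : ∀ t, 0 < α t) (hα1 : ∑ t, α t = 1) :
    HasPrekopaLeindler α (volume : Measure (ι → ℝ)) := by
  refine (hasPrekopaLeindler_pi_fin hα hα1 _).of_measurePreserving
    (LinearMap.funLeft ℝ ℝ (Fintype.equivFin ι)) ?_
  convert volume_measurePreserving_piCongrLeft (fun _ : ι => ℝ) (Fintype.equivFin ι).symm using 1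
  funext x i
  obtain ⟨j, rfl⟩ := (Fintype.equivFin ι).symm.surjective i
  simp [MeasurableEquiv.piCongrLeft, Equiv.piCongrLeft_apply_apply]

end PrekopaLeindler

section EdgeTables

variable {ι σ ρ : Type*} [Fintype ι] [DecidableEq σ] [DecidableEq ρ]

open Classical in
/-- The functions on `ι` whose sums over the fibers of `κ` are given by `k`. -/
noncomputable def fiberTables (κ : ι → ρ) (k : ρ → ℕ) : Finset (ι → ℕ) :=
  {a ∈ Fintype.piFinset fun q => Finset.Iic (k (κ q)) | ∀ c, ∑ q with κ q = c, a q = k c}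

theorem mem_fiberTables {κ : ι → ρ} {k : ρ → ℕ} {a : ι → ℕ} :
    a ∈ fiberTables κ k ↔ ∀ c, ∑ q with κ q = c, a q = k c := by
  simp only [fiberTables, Finset.mem_filter, Fintype.mem_piFinset, Finset.mem_Iic,
    and_iff_right_iff_imp]
  intro ha q
  rw [← ha (κ q)]
  exact Finset.single_le_sum_of_canonicallyOrdered (f := a) (by simp)

open Classical in
/-- The tables on the edges of a bipartite graph with prescribed sums at all nodes, where the edge
`q : ι` joins `ℓ q : σ` to `κ q : ρ`. -/
noncomputable def edgeTables (ℓ : ι → σ) (κ : ι → ρ) (β : σ → ℕ) (k : ρ → ℕ) :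
    Finset (ι → ℕ) :=
  fiberTables ℓ β ∩ fiberTables κ k

theorem mem_edgeTables {ℓ : ι → σ} {κ : ι → ρ} {β : σ → ℕ} {k : ρ → ℕ} {a : ι → ℕ} :
    a ∈ edgeTables ℓ κ β k ↔ a ∈ fiberTables ℓ β ∧ a ∈ fiberTables κ k :=
  Finset.mem_inter

theorem edgeTables_swap (ℓ : ι → σ) (κ : ι → ρ) (β : σ → ℕ) (k : ρ → ℕ) :
    edgeTables κ ℓ k β = edgeTables ℓ κ β k :=
  Finset.inter_comm _ _

/-- The exponential generating function of the tables with margins `β` and `k`. -/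
noncomputable def tableSum (ℓ : ι → σ) (κ : ι → ρ) (β : σ → ℕ) (k : ρ → ℕ) (x : ι → ℝ) : ℝ :=
  ∑ a ∈ edgeTables ℓ κ β k, ∏ q, x q ^ a q / ((a q).factorial : ℝ)

theorem tableSum_swap (ℓ : ι → σ) (κ : ι → ρ) (β : σ → ℕ) (k : ρ → ℕ) (x : ι → ℝ) :
    tableSum κ ℓ k β x = tableSum ℓ κ β k x := by
  rw [tableSum, edgeTables_swap, tableSum]

theorem tableSum_nonneg (ℓ : ι → σ) (κ : ι → ρ) (β : σ → ℕ) (k : ρ → ℕ) {x : ι → ℝ}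
    (hx : ∀ q, 0 ≤ x q) : 0 ≤ tableSum ℓ κ β k x :=
  Finset.sum_nonneg fun _ _ => Finset.prod_nonneg fun q _ =>
    div_nonneg (pow_nonneg (hx q) _) (Nat.cast_nonneg _)

section Multinomial

variable [Fintype ρ]

theorem sum_eq_sum_of_mem_fiberTables {κ : ι → ρ} {k : ρ → ℕ} {a : ι → ℕ}
    (ha : a ∈ fiberTables κ k) : ∑ q, a q = ∑ c, k c := by
  rw [← Finset.sum_fiberwise Finset.univ κ a]
  exact Finset.sum_congr rfl fun c _ => mem_fiberTables.mp ha c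

theorem sum_eq_sum_of_mem_edgeTables [Fintype σ] {ℓ : ι → σ} {κ : ι → ρ} {β : σ → ℕ} {k : ρ → ℕ}
    {a : ι → ℕ} (ha : a ∈ edgeTables ℓ κ β k) : ∑ s, β s = ∑ c, k c :=
  (sum_eq_sum_of_mem_fiberTables (mem_edgeTables.mp ha).1).symm.trans
    (sum_eq_sum_of_mem_fiberTables (mem_edgeTables.mp ha).2)

theorem prod_pow_eq_of_mem_fiberTables {κ : ι → ρ} {k : ρ → ℕ} {a : ι → ℕ}
    (ha : a ∈ fiberTables κ k) (u : ρ → ℝ) : ∏ c, u c ^ k c = ∏ q, u (κ q) ^ a q := by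
  rw [← Finset.prod_fiberwise Finset.univ κ]
  refine Finset.prod_congr rfl fun c _ => ?_
  rw [← mem_fiberTables.mp ha c, ← Finset.prod_pow_eq_pow_sum]
  exact Finset.prod_congr rfl fun q hq => by rw [(Finset.mem_filter.mp hq).2]

theorem sum_piFinset_piAntidiag [DecidableEq ι] {M : Type*} [AddCommMonoid M] (κ : ι → ρ)
    (k : ρ → ℕ) (F : (ι → ℕ) → M) :
    ∑ φ ∈ Fintype.piFinset fun c => Finset.piAntidiag {q | κ q = c} (k c), F (fun q => φ (κ q) q) =
      ∑ a ∈ fiberTables κ k, F a := by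
  refine Finset.sum_bij' (fun φ _ q => φ (κ q) q) (fun a _ c q => if κ q = c then a q else 0)
    (fun φ hφ => ?_) (fun a ha => ?_) (fun φ hφ => ?_) (fun a _ => ?_) fun φ _ => rfl
  · simp only [Fintype.mem_piFinset, Finset.mem_piAntidiag] at hφ
    refine mem_fiberTables.mpr fun c => (Finset.sum_congr rfl fun q hq => ?_).trans (hφ c).1
    rw [(Finset.mem_filter.mp hq).2]
  · simp only [Fintype.mem_piFinset, Finset.mem_piAntidiag]
    refine fun c => ⟨?_, fun q hq => by simpa using (ite_ne_right_iff.mp hq).1⟩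
    refine (Finset.sum_congr rfl fun q hq => ?_).trans (mem_fiberTables.mp ha c)
    rw [if_pos (Finset.mem_filter.mp hq).2]
  · simp only [Fintype.mem_piFinset, Finset.mem_piAntidiag] at hφ
    funext c q
    split_ifs with hq
    · obtain rfl := hq
      rfl
    · by_contra h0
      exact hq (Finset.mem_filter.mp ((hφ c).2 q (Ne.symm h0))).2
  · funext q
    exact if_pos rfl

theorem prod_sum_fiber_pow {S : Type*} [CommSemiring S] (κ : ι → ρ) (k : ρ → ℕ) (w : ι → S) :
    ∏ c, (∑ q with κ q = c, w q) ^ k c = ∑ a ∈ fiberTables κ k,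
      ((∏ c, Nat.multinomial {q | κ q = c} a : ℕ) : S) * ∏ q, w q ^ a q := by
  classical
  simp_rw [Finset.sum_pow_eq_sum_piAntidiag, Finset.prod_univ_sum]
  rw [← sum_piFinset_piAntidiag]
  refine Finset.sum_congr rfl fun φ _ => ?_
  rw [Finset.prod_mul_distrib, Nat.cast_prod, ← Finset.prod_fiberwise Finset.univ κ]
  have hκ {c : ρ} {q : ι} (hq : q ∈ ({q | κ q = c} : Finset ι)) : φ c q = φ (κ q) q := by
    rw [(Finset.mem_filter.mp hq).2]
  congr 1
  · exact Finset.prod_congr rfl fun c _ => congrArg _ (Nat.multinomial_congr fun q hq => hκ hq)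
  · exact Finset.prod_congr rfl fun c _ => Finset.prod_congr rfl fun q hq => by rw [hκ hq]

theorem prod_multinomial_eq {κ : ι → ρ} {k : ρ → ℕ} {a : ι → ℕ} (ha : a ∈ fiberTables κ k) :
    ((∏ c, Nat.multinomial {q | κ q = c} a : ℕ) : ℝ) =
      (∏ c, ((k c).factorial : ℝ)) * ∏ q, ((a q).factorial : ℝ)⁻¹ := by
  rw [Finset.prod_inv_distrib, eq_mul_inv_iff_mul_eq₀
    (Finset.prod_ne_zero_iff.mpr fun q _ => Nat.cast_ne_zero.mpr (a q).factorial_ne_zero),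
    ← Finset.prod_fiberwise Finset.univ κ, Nat.cast_prod, ← Finset.prod_mul_distrib]
  refine Finset.prod_congr rfl fun c _ => ?_
  rw [← mem_fiberTables.mp ha c, ← Nat.multinomial_spec, Nat.cast_mul, Nat.cast_prod, mul_comm]

theorem prod_sum_fiber_pow_eq_factorial_mul (κ : ι → ρ) (k : ρ → ℕ) (w : ι → ℝ) :
    ∏ c, (∑ q with κ q = c, w q) ^ k c =
      (∏ c, ((k c).factorial : ℝ)) *
        ∑ a ∈ fiberTables κ k, ∏ q, w q ^ a q / ((a q).factorial : ℝ) := by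
  rw [prod_sum_fiber_pow, Finset.mul_sum]
  refine Finset.sum_congr rfl fun a ha => ?_
  rw [prod_multinomial_eq ha, mul_assoc, ← Finset.prod_mul_distrib]
  simp only [div_eq_inv_mul]

end Multinomial

section Coefficient

open MvPolynomial

/-- The total weight of the edges joining `s` to `c`. -/
def edgeWeight {S : Type*} [AddCommMonoid S] (ℓ : ι → σ) (κ : ι → ρ) (x : ι → S) (c : ρ) (s : σ) :
    S :=
  ∑ q with κ q = c ∧ ℓ q = s, x q

theorem sum_map_edgeWeight_mul [Fintype σ] {S T : Type*} [Semiring S] [Semiring T] (f : S →+* T)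
    (ℓ : ι → σ) (κ : ι → ρ) (x : ι → S) (y : σ → T) (c : ρ) :
    ∑ s, f (edgeWeight ℓ κ x c s) * y s = ∑ q with κ q = c, f (x q) * y (ℓ q) := by
  rw [← Finset.sum_fiberwise _ ℓ]
  refine Finset.sum_congr rfl fun s _ => ?_
  rw [edgeWeight, map_sum, Finset.sum_mul, Finset.filter_filter]
  exact Finset.sum_congr rfl fun q hq => by rw [(Finset.mem_filter.mp hq).2.2]

theorem coeff_prod_C_mul_X_pow (ℓ : ι → σ) (β : σ →₀ ℕ) (x : ι → ℝ) (a : ι → ℕ) :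
    coeff β (∏ q, (C (x q) * X (ℓ q)) ^ a q) =
      if a ∈ fiberTables ℓ β then ∏ q, x q ^ a q else 0 := by
  have hmonomial : ∏ q, (C (x q) * X (ℓ q)) ^ a q =
      monomial (∑ q, Finsupp.single (ℓ q) (a q)) (∏ q, x q ^ a q) := by
    rw [monomial_sum_prod]
    refine Finset.prod_congr rfl fun q _ => ?_
    rw [C_mul_X_eq_monomial, monomial_pow, Finsupp.smul_single, smul_eq_mul, mul_one]
  have hdegree : ∑ q, Finsupp.single (ℓ q) (a q) = β ↔ a ∈ fiberTables ℓ β := by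
    simp only [mem_fiberTables, DFunLike.ext_iff, Finsupp.finsetSum_apply, Finset.sum_filter,
      Finsupp.single_apply]
  simp only [hmonomial, coeff_monomial, hdegree]

theorem coeff_prodLinearPow_edgeWeight [Fintype ρ] [Fintype σ] (ℓ : ι → σ) (κ : ι → ρ)
    (β : σ →₀ ℕ) (k : ρ → ℕ) (x : ι → ℝ) : coeff β (prodLinearPow (edgeWeight ℓ κ x) k) =
      (∏ c, ((k c).factorial : ℝ)) * tableSum ℓ κ β k x := by
  classical
  simp_rw [prodLinearPow, sum_map_edgeWeight_mul]
  rw [prod_sum_fiber_pow, coeff_sum, tableSum, Finset.mul_sum, edgeTables, Finset.inter_comm,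
    ← Finset.filter_mem_eq_inter, Finset.sum_filter]
  refine Finset.sum_congr rfl fun a ha => ?_
  rw [← map_natCast C, coeff_C_mul, coeff_prod_C_mul_X_pow, mul_ite, mul_zero,
    prod_multinomial_eq ha, mul_assoc, ← Finset.prod_mul_distrib]
  simp only [div_eq_inv_mul]

end Coefficient

end EdgeTables

section EdgeCapacity

variable {ι σ ρ τ : Type*} [Fintype ι] [Fintype σ] [Fintype ρ] [Fintype τ]

/-- The number `F` is a lower bound for the infimum over `y` and `v` of
`(∑ q, x q * y (ℓ q) * v (κ q)) ^ D / (D ^ D * y ^ β * v ^ k)`, where `D` is the sum of `k`. The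
denominators are cleared, so that `y` and `v` may have zero entries. -/
def IsEdgeCapacityBound (ℓ : ι → σ) (κ : ι → ρ) (β : σ → ℕ) (k : ρ → ℕ) (x : ι → ℝ) (F : ℝ) :
    Prop :=
  ∀ (y : σ → ℝ) (v : ρ → ℝ), (∀ s, 0 ≤ y s) → (∀ c, 0 ≤ v c) →
    F * ((∏ s, y s ^ β s) * ∏ c, v c ^ k c) * ((∑ c, k c : ℕ) : ℝ) ^ (∑ c, k c) ≤
      (∑ q, x q * y (ℓ q) * v (κ q)) ^ (∑ c, k c)

theorem IsEdgeCapacityBound.swap {ℓ : ι → σ} {κ : ι → ρ} {β : σ → ℕ} {k : ρ → ℕ} {x : ι → ℝ}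
    {F : ℝ} (hβ : ∑ s, β s = ∑ c, k c) (h : IsEdgeCapacityBound κ ℓ k β x F) :
    IsEdgeCapacityBound ℓ κ β k x F := by
  intro y v hy hv
  simpa only [hβ, mul_comm (∏ c, v c ^ k c), mul_right_comm] using h v y hv hy

theorem pow_self_pos (n : ℕ) : (0 : ℝ) < (n : ℝ) ^ n := by
  exact_mod_cast Nat.pow_self_pos

theorem vecOmega_mul_prod_factorial (k : ρ → ℕ) :
    vecOmega k * ∏ c, ((k c).factorial : ℝ) = ∏ c, (k c : ℝ) ^ k c := by
  rw [vecOmega, ← Finset.prod_mul_distrib]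
  exact Finset.prod_congr rfl fun c _ =>
    div_mul_cancel₀ _ (Nat.cast_ne_zero.mpr (k c).factorial_ne_zero)

section UpperBound

variable [DecidableEq σ] [DecidableEq ρ] {ℓ : ι → σ} {κ : ι → ρ} {β : σ → ℕ} {k : ρ → ℕ}
  {x : ι → ℝ}

theorem prod_factorial_mul_tableSum_mul_le (hx : ∀ q, 0 ≤ x q) {y : σ → ℝ} (hy : ∀ s, 0 ≤ y s)
    {v : ρ → ℝ} (hv : ∀ c, 0 ≤ v c) :
    (∏ c, ((k c).factorial : ℝ)) *
        (tableSum ℓ κ β k x * ((∏ s, y s ^ β s) * ∏ c, v c ^ k c)) ≤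
      ∏ c, (∑ q with κ q = c, x q * y (ℓ q) * v (κ q)) ^ k c := by
  classical
  have hmonomial (a : ι → ℕ) (ha : a ∈ edgeTables ℓ κ β k) :
      (∏ q, x q ^ a q / ((a q).factorial : ℝ)) * ((∏ s, y s ^ β s) * ∏ c, v c ^ k c) =
        ∏ q, (x q * y (ℓ q) * v (κ q)) ^ a q / ((a q).factorial : ℝ) := by
    obtain ⟨hβ, hk⟩ := mem_edgeTables.mp ha
    rw [prod_pow_eq_of_mem_fiberTables hβ, prod_pow_eq_of_mem_fiberTables hk,
      ← Finset.prod_mul_distrib, ← Finset.prod_mul_distrib]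
    refine Finset.prod_congr rfl fun q _ => ?_
    rw [mul_pow, mul_pow, mul_assoc, mul_div_right_comm]
  rw [prod_sum_fiber_pow_eq_factorial_mul, tableSum, Finset.sum_mul,
    Finset.sum_congr rfl hmonomial]
  refine mul_le_mul_of_nonneg_left (Finset.sum_le_sum_of_subset_of_nonneg
    Finset.inter_subset_right fun a _ _ => Finset.prod_nonneg fun q _ => ?_)
    (Finset.prod_nonneg fun c _ => Nat.cast_nonneg _)
  have := mul_nonneg (mul_nonneg (hx q) (hy (ℓ q))) (hv (κ q))
  positivity

theorem isEdgeCapacityBound_tableSum_div_vecOmega (hx : ∀ q, 0 ≤ x q) :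
    IsEdgeCapacityBound ℓ κ β k x (tableSum ℓ κ β k x / vecOmega k) := by
  intro y v hy hv
  set D := ∑ c, k c
  set P := (∏ s, y s ^ β s) * ∏ c, v c ^ k c
  set g : ρ → ℝ := fun c => ∑ q with κ q = c, x q * y (ℓ q) * v (κ q)
  have hfactorial : 0 < ∏ c, ((k c).factorial : ℝ) :=
    Finset.prod_pos fun c _ => Nat.cast_pos.mpr (k c).factorial_pos
  have hmean := prod_pow_mul_sum_pow_le k g fun c =>
    Finset.sum_nonneg fun q _ => mul_nonneg (mul_nonneg (hx q) (hy _)) (hv _)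
  rw [Finset.sum_fiberwise Finset.univ κ, ← vecOmega_mul_prod_factorial] at hmean
  rw [div_mul_eq_mul_div, div_mul_eq_mul_div, div_le_iff₀' (vecOmega_pos k)]
  refine le_of_mul_le_mul_left ?_ hfactorial
  calc (∏ c, ((k c).factorial : ℝ)) * (tableSum ℓ κ β k x * P * (D : ℝ) ^ D)
      = (∏ c, ((k c).factorial : ℝ)) * (tableSum ℓ κ β k x * P) * (D : ℝ) ^ D := by ring
    _ ≤ (∏ c, g c ^ k c) * (D : ℝ) ^ D := mul_le_mul_of_nonneg_right
        (prod_factorial_mul_tableSum_mul_le hx hy hv) (pow_self_pos D).le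
    _ ≤ vecOmega k * (∏ c, ((k c).factorial : ℝ)) *
          (∑ q, x q * y (ℓ q) * v (κ q)) ^ D := hmean
    _ = _ := by ring

theorem isEdgeCapacityBound_tableSum_div_min (hβ : ∑ s, β s = ∑ c, k c) (hx : ∀ q, 0 ≤ x q) :
    IsEdgeCapacityBound ℓ κ β k x (tableSum ℓ κ β k x / min (vecOmega β) (vecOmega k)) := by
  rcases min_choice (vecOmega β) (vecOmega k) with h | h <;> rw [h]
  · rw [← tableSum_swap]
    exact (isEdgeCapacityBound_tableSum_div_vecOmega hx).swap hβ
  · exact isEdgeCapacityBound_tableSum_div_vecOmega hx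

end UpperBound

section LogConcavity

variable {α : τ → ℝ}

theorem real_prod_rpow_eq_self (hα : ∀ t, 0 ≤ α t) (hα1 : ∑ t, α t = 1) {r : ℝ} (hr : 0 ≤ r) :
    ∏ t, r ^ α t = r := by
  rw [← Real.rpow_sum_of_nonneg hr fun t _ => hα t, hα1, Real.rpow_one]

theorem prod_prod_pow_rpow (hα : ∀ t, 0 ≤ α t) {b : τ → σ → ℕ} {β : σ → ℕ}
    (hβ : ∀ s, (β s : ℝ) = ∑ t, α t * b t s) {y : σ → ℝ} (hy : ∀ s, 0 ≤ y s) :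
    ∏ t, (∏ s, y s ^ b t s) ^ α t = ∏ s, y s ^ β s := by
  have hfactor (t : τ) : (∏ s, y s ^ b t s) ^ α t = ∏ s, y s ^ (α t * b t s) := by
    rw [← Real.finsetProd_rpow _ _ fun s _ => pow_nonneg (hy s) _]
    exact Finset.prod_congr rfl fun s _ => by
      rw [← Real.rpow_natCast, ← Real.rpow_mul (hy s), mul_comm]
  rw [Finset.prod_congr rfl fun t _ => hfactor t, Finset.prod_comm]
  refine Finset.prod_congr rfl fun s _ => ?_
  rw [← Real.rpow_sum_of_nonneg (hy s) fun t _ => mul_nonneg (hα t) (Nat.cast_nonneg _), ← hβ,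
    Real.rpow_natCast]

theorem IsEdgeCapacityBound.prod_rpow (hα : ∀ t, 0 ≤ α t) (hα1 : ∑ t, α t = 1) {ℓ : ι → σ}
    {κ : ι → ρ} {k : ρ → ℕ} {b : τ → σ → ℕ} {β : σ → ℕ}
    (hβ : ∀ s, (β s : ℝ) = ∑ t, α t * b t s) {x : τ → ι → ℝ} (hx : ∀ t q, 0 ≤ x t q) {F : τ → ℝ}
    (hF : ∀ t, 0 ≤ F t) (h : ∀ t, IsEdgeCapacityBound ℓ κ (b t) k (x t) (F t)) :
    IsEdgeCapacityBound ℓ κ β k (∑ t, α t • x t) (∏ t, F t ^ α t) := by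
  intro y v hy hv
  set D := ∑ c, k c
  set L : τ → ℝ := fun t => ∑ q, x t q * y (ℓ q) * v (κ q)
  have hL (t : τ) : 0 ≤ L t :=
    Finset.sum_nonneg fun q _ => mul_nonneg (mul_nonneg (hx t q) (hy _)) (hv _)
  have hY (t : τ) : 0 ≤ ∏ s, y s ^ b t s := Finset.prod_nonneg fun s _ => pow_nonneg (hy s) _
  have hV : 0 ≤ ∏ c, v c ^ k c := Finset.prod_nonneg fun c _ => pow_nonneg (hv c) _
  have hD : (0 : ℝ) ≤ (D : ℝ) ^ D := (pow_self_pos D).le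
  have hFYV (t : τ) : 0 ≤ F t * ((∏ s, y s ^ b t s) * ∏ c, v c ^ k c) :=
    mul_nonneg (hF t) (mul_nonneg (hY t) hV)
  calc (∏ t, F t ^ α t) * ((∏ s, y s ^ β s) * ∏ c, v c ^ k c) * (D : ℝ) ^ D
      = ∏ t, (F t * ((∏ s, y s ^ b t s) * ∏ c, v c ^ k c) * (D : ℝ) ^ D) ^ α t := by
        simp only [Real.mul_rpow (hFYV _) hD, Real.mul_rpow (hF _) (mul_nonneg (hY _) hV),
          Real.mul_rpow (hY _) hV, Finset.prod_mul_distrib, prod_prod_pow_rpow hα hβ hy,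
          real_prod_rpow_eq_self hα hα1 hV, real_prod_rpow_eq_self hα hα1 hD]
    _ ≤ ∏ t, (L t ^ D) ^ α t :=
        Finset.prod_le_prod (fun t _ => Real.rpow_nonneg (mul_nonneg (hFYV t) hD) _) fun t _ =>
          Real.rpow_le_rpow (mul_nonneg (hFYV t) hD) (h t y v hy hv) (hα t)
    _ = (∏ t, L t ^ α t) ^ D := by
        rw [← Finset.prod_pow]
        exact Finset.prod_congr rfl fun t _ => (Real.rpow_pow_comm (hL t) _ _).symm
    _ ≤ (∑ t, α t * L t) ^ D :=
        pow_le_pow_left₀ (Finset.prod_nonneg fun t _ => Real.rpow_nonneg (hL t) _)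
          (Real.geom_mean_le_arith_mean_weighted Finset.univ α L (fun t _ => hα t) hα1
            fun t _ => hL t) D
    _ = (∑ q, (∑ t, α t • x t) q * y (ℓ q) * v (κ q)) ^ D := by
        simp only [L, Finset.mul_sum, Finset.sum_apply, Pi.smul_apply, smul_eq_mul,
          Finset.sum_mul, mul_assoc]
        rw [Finset.sum_comm]

end LogConcavity

section LowerBound

variable {ℓ : ι → σ} {κ : ι → ρ} {β : σ → ℕ} {k : ρ → ℕ} {x : ι → ℝ} {F : ℝ}

namespace IsEdgeCapacityBound

theorem exists_pos (h : IsEdgeCapacityBound ℓ κ β k x F) (hx : ∀ q, 0 ≤ x q) (hF : 0 < F)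
    {c : ρ} (hc : k c ≠ 0) : ∃ q, κ q = c ∧ 0 < x q := by
  classical
  by_contra! hzero
  set D := ∑ c, k c
  have hFD : 0 < F * (D : ℝ) ^ D := mul_pos hF (pow_self_pos D)
  -- Otherwise the right-hand side of the bound does not depend on `v c`.
  have hbound (r : ℝ) (hr : 1 ≤ r) : r * (F * (D : ℝ) ^ D) ≤ (∑ q, x q) ^ D := by
    have hr0 : 0 ≤ r := zero_le_one.trans hr
    have hv (d : ρ) : 0 ≤ Function.update (1 : ρ → ℝ) c r d := by
      rw [Function.update_apply]
      split_ifs <;> simp [hr0]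
    have hedge (q : ι) : x q * 1 * Function.update (1 : ρ → ℝ) c r (κ q) = x q := by
      by_cases hq : κ q = c
      · rw [(hzero q hq).antisymm (hx q), zero_mul, zero_mul]
      · rw [Function.update_of_ne hq, Pi.one_apply, mul_one, mul_one]
    have hpow : ∏ d, Function.update (1 : ρ → ℝ) c r d ^ k d = r ^ k c := by
      rw [Finset.prod_eq_single c (fun d _ hd => by simp [hd]) (by simp), Function.update_self]
    have hr' := h 1 _ (fun _ => zero_le_one) hv
    simp only [Pi.one_apply, hedge, hpow, one_pow, Finset.prod_const_one, one_mul] at hr'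
    calc r * (F * (D : ℝ) ^ D) ≤ r ^ k c * (F * (D : ℝ) ^ D) :=
          mul_le_mul_of_nonneg_right (le_self_pow₀ hr hc) hFD.le
      _ = F * r ^ k c * (D : ℝ) ^ D := by ring
      _ ≤ _ := hr'
  obtain ⟨n, hn⟩ := exists_nat_gt ((∑ q, x q) ^ D / (F * (D : ℝ) ^ D))
  have hlt : (∑ q, x q) ^ D < n * (F * (D : ℝ) ^ D) := (div_lt_iff₀ hFD).mp hn
  have := hbound (n + 1) (by simp)
  linarith

variable [DecidableEq ρ]

-- The choice `v c = k c / ∑ q with κ q = c, x q * y (ℓ q)` equates the sum over the edges to `D`.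
theorem mul_prod_pow_le (h : IsEdgeCapacityBound ℓ κ β k x F) (hx : ∀ q, 0 ≤ x q) (hF : 0 < F)
    {y : σ → ℝ} (hy : ∀ s, 0 < y s) :
    F * (∏ c, (k c : ℝ) ^ k c) * ∏ s, y s ^ β s ≤
      ∏ c, (∑ q with κ q = c, x q * y (ℓ q)) ^ k c := by
  set D := ∑ c, k c
  set g : ρ → ℝ := fun c => ∑ q with κ q = c, x q * y (ℓ q)
  have hterm (q : ι) : 0 ≤ x q * y (ℓ q) := mul_nonneg (hx q) (hy _).le
  have hg (c : ρ) (hc : k c ≠ 0) : 0 < g c := by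
    obtain ⟨q, hq, hxq⟩ := h.exists_pos hx hF hc
    exact Finset.sum_pos' (fun q _ => hterm q) ⟨q, by simpa using hq, mul_pos hxq (hy _)⟩
  have hsum : ∑ q, x q * y (ℓ q) * (k (κ q) / g (κ q)) = D := by
    rw [← Finset.sum_fiberwise Finset.univ κ, Nat.cast_sum]
    refine Finset.sum_congr rfl fun c _ => ?_
    rw [Finset.sum_congr rfl fun q hq => by rw [(Finset.mem_filter.mp hq).2], ← Finset.sum_mul]
    obtain hc | hc := eq_or_ne (k c) 0
    · simp [hc]
    · exact mul_div_cancel₀ _ (hg c hc).ne'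
  have hgk (c : ρ) : 0 < g c ^ k c := by
    obtain hc | hc := eq_or_ne (k c) 0
    · simp [hc]
    · exact pow_pos (hg c hc) _
  have hbound := h y (fun c => k c / g c) (fun s => (hy s).le) fun c =>
    div_nonneg (Nat.cast_nonneg _) (Finset.sum_nonneg fun q _ => hterm q)
  rw [hsum, mul_le_iff_le_one_left (pow_self_pos D)] at hbound
  simp only [div_pow, Finset.prod_div_distrib] at hbound
  rw [mul_div_assoc', mul_div_assoc', div_le_one (Finset.prod_pos fun c _ => hgk c)] at hbound
  calc F * (∏ c, (k c : ℝ) ^ k c) * ∏ s, y s ^ β s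
      = F * ((∏ s, y s ^ β s) * ∏ c, (k c : ℝ) ^ k c) := by ring
    _ ≤ _ := hbound

theorem le_tableSum [DecidableEq σ] (h : IsEdgeCapacityBound ℓ κ β k x F) (hx : ∀ q, 0 ≤ x q)
    (hβ : ∑ s, β s = ∑ c, k c) :
    F ≤ omega (∑ c, k c) * tableSum ℓ κ β k x / (vecOmega β * vecOmega k) := by
  obtain hF | hF := le_or_gt F 0
  · exact hF.trans (div_nonneg (mul_nonneg (omega_pos _).le (tableSum_nonneg ℓ κ β k hx))
      (mul_pos (vecOmega_pos _) (vecOmega_pos _)).le)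
  obtain ⟨β, rfl⟩ := Finsupp.equivFunOnFinite.surjective β
  change F ≤ omega _ * tableSum ℓ κ (⇑β) k x / (vecOmega (⇑β) * vecOmega k)
  have hcoeff := le_coeff_prodLinearPow (a := edgeWeight ℓ κ x)
    (fun c s => Finset.sum_nonneg fun q _ => hx q) (k := k) (β := β) hβ
    (mul_pos hF (Finset.prod_pos fun c _ => pow_self_pos (k c))) fun y hy => by
      rw [aeval_prodLinearPow]
      simp only [sum_map_edgeWeight_mul]
      exact h.mul_prod_pow_le hx hF hy
  rw [coeff_prodLinearPow_edgeWeight, ← vecOmega_mul_prod_factorial, mul_div_assoc',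
    div_le_iff₀ (omega_pos _)] at hcoeff
  rw [le_div_iff₀ (mul_pos (vecOmega_pos _) (vecOmega_pos _))]
  refine le_of_mul_le_mul_left ?_
    (Finset.prod_pos fun c _ => Nat.cast_pos.mpr (k c).factorial_pos :
      0 < ∏ c, ((k c).factorial : ℝ))
  calc _ = F * (vecOmega k * ∏ c, ((k c).factorial : ℝ)) * vecOmega β := by
        ring
    _ ≤ _ := hcoeff
    _ = _ := by
        ring

end IsEdgeCapacityBound

end LowerBound

section TableSum

variable {α : τ → ℝ} {b : τ → σ → ℕ} {β : σ → ℕ}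

theorem sum_eq_sum_of_weighted_mean (hα1 : ∑ t, α t = 1) (hβ : ∀ s, (β s : ℝ) = ∑ t, α t * b t s)
    {D : ℕ} (hb : ∀ t, ∑ s, b t s = D) : ∑ s, β s = D := by
  have hcast : ((∑ s, β s : ℕ) : ℝ) = D := by
    rw [Nat.cast_sum, Finset.sum_congr rfl fun s _ => hβ s, Finset.sum_comm]
    simp only [← Finset.mul_sum, ← Nat.cast_sum, hb, ← Finset.sum_mul, hα1, one_mul]
  exact_mod_cast hcast

variable [DecidableEq σ] [DecidableEq ρ] {ℓ : ι → σ} {κ : ι → ρ} {k : ρ → ℕ}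

theorem prod_tableSum_rpow_le (hα : ∀ t, 0 < α t) (hα1 : ∑ t, α t = 1)
    (hβ : ∀ s, (β s : ℝ) = ∑ t, α t * b t s) {x : τ → ι → ℝ} (hx : ∀ t q, 0 ≤ x t q) :
    ∏ t, (tableSum ℓ κ (b t) k (x t) / min (vecOmega (b t)) (vecOmega k)) ^ α t ≤
      omega (∑ c, k c) * tableSum ℓ κ β k (∑ t, α t • x t) / (vecOmega β * vecOmega k) := by
  have hz (q : ι) : 0 ≤ (∑ t, α t • x t) q := by
    rw [Finset.sum_apply]
    exact Finset.sum_nonneg fun t _ => mul_nonneg (hα t).le (hx t q)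
  have hmin (t : τ) : 0 < min (vecOmega (b t)) (vecOmega k) :=
    lt_min (vecOmega_pos _) (vecOmega_pos _)
  by_cases hempty : ∃ t, edgeTables ℓ κ (b t) k = ∅
  · obtain ⟨t, ht⟩ := hempty
    rw [Finset.prod_eq_zero (Finset.mem_univ t)]
    · exact div_nonneg (mul_nonneg (omega_pos _).le (tableSum_nonneg ℓ κ β k hz))
        (mul_pos (vecOmega_pos _) (vecOmega_pos _)).le
    · rw [tableSum, ht, Finset.sum_empty, zero_div, Real.zero_rpow (hα t).ne']
  push Not at hempty
  have hb (t : τ) : ∑ s, b t s = ∑ c, k c :=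
    sum_eq_sum_of_mem_edgeTables (hempty t).choose_spec
  have hbound := IsEdgeCapacityBound.prod_rpow (fun t => (hα t).le) hα1 hβ hx
    (fun t => div_nonneg (tableSum_nonneg ℓ κ (b t) k (hx t)) (hmin t).le)
    fun t => isEdgeCapacityBound_tableSum_div_min (hb t) (hx t)
  exact hbound.le_tableSum hz (sum_eq_sum_of_weighted_mean hα1 hβ hb)

end TableSum

end EdgeCapacity

section IntegralRepresentation

open MeasureTheory ProbabilityTheory

theorem gammaPDFReal_add_one_one (a : ℕ) {r : ℝ} (hr : 0 ≤ r) :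
    gammaPDFReal (a + 1) 1 r = r ^ a / (a.factorial : ℝ) * Real.exp (-r) := by
  rw [gammaPDFReal, if_pos hr, Real.one_rpow, Real.Gamma_nat_eq_factorial, add_sub_cancel_right,
    Real.rpow_natCast, one_mul, one_div_mul_eq_div]

theorem integrable_gammaPDFReal {a r : ℝ} (ha : 0 < a) (hr : 0 < r) :
    Integrable (gammaPDFReal a r) := by
  rw [← lintegral_ofReal_ne_top_iff_integrable
    (measurable_gammaPDFReal a r).aestronglyMeasurable
    (ae_of_all _ (gammaPDFReal_nonneg ha hr))]
  exact (lintegral_gammaPDF_eq_one ha hr).trans_ne ENNReal.one_ne_top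

theorem integral_gammaPDFReal {a r : ℝ} (ha : 0 < a) (hr : 0 < r) :
    ∫ x, gammaPDFReal a r x = 1 := by
  rw [integral_eq_lintegral_of_nonneg_ae (ae_of_all _ (gammaPDFReal_nonneg ha hr))
    (measurable_gammaPDFReal a r).aestronglyMeasurable]
  exact (congrArg ENNReal.toReal (lintegral_gammaPDF_eq_one ha hr)).trans ENNReal.toReal_one

variable {ι σ ρ τ : Type*} [Fintype ι] [DecidableEq σ] [DecidableEq ρ]

/-- The sum of the densities, over the tables `a` with margins `β` and `k`, of a family of
independent gamma variables with shape parameters `a q + 1` and rate `1`. -/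
noncomputable def tableDensity (ℓ : ι → σ) (κ : ι → ρ) (β : σ → ℕ) (k : ρ → ℕ) (x : ι → ℝ) : ℝ :=
  ∑ a ∈ edgeTables ℓ κ β k, ∏ q, gammaPDFReal (a q + 1) 1 (x q)

section Density

variable (ℓ : ι → σ) (κ : ι → ρ) (β : σ → ℕ) (k : ρ → ℕ)

theorem tableDensity_nonneg : 0 ≤ tableDensity ℓ κ β k := fun x =>
  Finset.sum_nonneg fun a _ => Finset.prod_nonneg fun q _ =>
    gammaPDFReal_nonneg (Nat.cast_add_one_pos (a q)) one_pos (x q)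

theorem measurable_tableDensity : Measurable (tableDensity ℓ κ β k) :=
  Finset.measurable_fun_sum _ fun a _ => Finset.measurable_fun_prod _ fun q _ =>
    (measurable_gammaPDFReal (a q + 1) 1).comp (measurable_pi_apply q)

theorem tableDensity_of_nonneg {x : ι → ℝ} (hx : ∀ q, 0 ≤ x q) :
    tableDensity ℓ κ β k x = tableSum ℓ κ β k x * Real.exp (-∑ q, x q) := by
  rw [tableSum, Finset.sum_mul]
  refine Finset.sum_congr rfl fun a _ => ?_
  rw [← Finset.sum_neg_distrib, Real.exp_sum, ← Finset.prod_mul_distrib]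
  exact Finset.prod_congr rfl fun q _ => gammaPDFReal_add_one_one (a q) (hx q)

theorem tableDensity_of_neg {x : ι → ℝ} {q : ι} (hq : x q < 0) : tableDensity ℓ κ β k x = 0 :=
  Finset.sum_eq_zero fun _ _ => Finset.prod_eq_zero (Finset.mem_univ q) (if_neg hq.not_ge)

theorem integrable_prod_gammaPDFReal (a : ι → ℕ) :
    Integrable fun x : ι → ℝ => ∏ q, gammaPDFReal (a q + 1) 1 (x q) :=
  Integrable.fintype_prod fun q => integrable_gammaPDFReal (Nat.cast_add_one_pos (a q)) one_pos

theorem integrable_tableDensity : Integrable (tableDensity ℓ κ β k) :=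
  integrable_finsetSum _ fun a _ => integrable_prod_gammaPDFReal a

theorem integral_tableDensity : ∫ x, tableDensity ℓ κ β k x = (edgeTables ℓ κ β k).card := by
  have hone (a : ι → ℕ) : ∫ x : ι → ℝ, ∏ q, gammaPDFReal (a q + 1) 1 (x q) = 1 := by
    rw [integral_fintype_prod_volume_eq_prod fun q => gammaPDFReal (a q + 1) 1]
    exact Finset.prod_eq_one fun q _ =>
      integral_gammaPDFReal (Nat.cast_add_one_pos (a q)) one_pos
  simp only [tableDensity, integral_finsetSum _ fun a _ => integrable_prod_gammaPDFReal a, hone,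
    Finset.sum_const, nsmul_eq_mul, mul_one]

end Density

variable [Fintype σ] [Fintype ρ] [Fintype τ] {ℓ : ι → σ} {κ : ι → ρ} {k : ρ → ℕ} {α : τ → ℝ}
  {b : τ → σ → ℕ} {β : σ → ℕ}

theorem prod_tableDensity_rpow_le (hα : ∀ t, 0 < α t) (hα1 : ∑ t, α t = 1)
    (hβ : ∀ s, (β s : ℝ) = ∑ t, α t * b t s) (x : τ → ι → ℝ) :
    ∏ t, (tableDensity ℓ κ (b t) k (x t) / min (vecOmega (b t)) (vecOmega k)) ^ α t ≤
      omega (∑ c, k c) * tableDensity ℓ κ β k (∑ t, α t • x t) / (vecOmega β * vecOmega k) := by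
  by_cases hx : ∀ t q, 0 ≤ x t q
  · have hz (q : ι) : (∑ t, α t • x t) q = ∑ t, α t * x t q := Finset.sum_apply _ _ _
    have hz0 (q : ι) : 0 ≤ (∑ t, α t • x t) q :=
      (hz q).symm ▸ Finset.sum_nonneg fun t _ => mul_nonneg (hα t).le (hx t q)
    have hquot (t : τ) :
        0 ≤ tableSum ℓ κ (b t) k (x t) / min (vecOmega (b t)) (vecOmega k) :=
      div_nonneg (tableSum_nonneg _ _ _ _ (hx t)) (lt_min (vecOmega_pos _) (vecOmega_pos _)).le
    have hexp : ∏ t, Real.exp (-∑ q, x t q) ^ α t = Real.exp (-∑ q, (∑ t, α t • x t) q) := by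
      simp only [← Real.exp_mul, ← Real.exp_sum, hz, neg_mul, Finset.sum_neg_distrib,
        Finset.sum_mul, mul_comm (x _ _)]
      rw [Finset.sum_comm]
    simp only [tableDensity_of_nonneg _ _ _ _ (hx _), tableDensity_of_nonneg _ _ _ _ hz0,
      mul_div_right_comm _ (Real.exp _), Real.mul_rpow (hquot _) (Real.exp_pos _).le,
      Finset.prod_mul_distrib, hexp, ← mul_assoc]
    exact mul_le_mul_of_nonneg_right (prod_tableSum_rpow_le hα hα1 hβ hx) (Real.exp_pos _).le
  · push Not at hx
    obtain ⟨t, q, hq⟩ := hx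
    rw [Finset.prod_eq_zero (Finset.mem_univ t)]
    · exact div_nonneg (mul_nonneg (omega_pos _).le (tableDensity_nonneg ℓ κ β k _))
        (mul_pos (vecOmega_pos _) (vecOmega_pos _)).le
    · rw [tableDensity_of_neg _ _ _ _ hq, zero_div, Real.zero_rpow (hα t).ne']

theorem prod_card_edgeTables_rpow_le_of_pos (hα : ∀ t, 0 < α t) (hα1 : ∑ t, α t = 1)
    (hβ : ∀ s, (β s : ℝ) = ∑ t, α t * b t s) :
    ∏ t, (((edgeTables ℓ κ (b t) k).card : ℝ) / min (vecOmega (b t)) (vecOmega k)) ^ α t ≤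
      omega (∑ c, k c) * (edgeTables ℓ κ β k).card / (vecOmega β * vecOmega k) := by
  have hmin (t : τ) : 0 ≤ min (vecOmega (b t)) (vecOmega k) :=
    (lt_min (vecOmega_pos _) (vecOmega_pos _)).le
  have hintegral := (hasPrekopaLeindler_pi (ι := ι) hα hα1).prod_integral_rpow_le
    (fun t => (hα t).le)
    (fun t => (measurable_tableDensity ℓ κ (b t) k).div_const _)
    (fun t => (integrable_tableDensity ℓ κ (b t) k).div_const _)
    (fun t x => div_nonneg (tableDensity_nonneg ℓ κ (b t) k x) (hmin t))
    (((measurable_tableDensity ℓ κ β k).const_mul _).div_const _)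
    (((integrable_tableDensity ℓ κ β k).const_mul _).div_const _)
    (fun x => div_nonneg (mul_nonneg (omega_pos _).le (tableDensity_nonneg ℓ κ β k x))
      (mul_pos (vecOmega_pos β) (vecOmega_pos k)).le)
    (prod_tableDensity_rpow_le hα hα1 hβ)
  simpa only [integral_div, integral_const_mul, integral_tableDensity] using hintegral

theorem prod_card_edgeTables_rpow_le (hα : ∀ t, 0 ≤ α t) (hα1 : ∑ t, α t = 1)
    (hβ : ∀ s, (β s : ℝ) = ∑ t, α t * b t s) :
    ∏ t, (((edgeTables ℓ κ (b t) k).card : ℝ) / min (vecOmega (b t)) (vecOmega k)) ^ α t ≤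
      omega (∑ c, k c) * (edgeTables ℓ κ β k).card / (vecOmega β * vecOmega k) := by
  classical
  have hpos {t : τ} (ht : α t ≠ 0) : 0 < α t := (hα t).lt_of_ne' ht
  have hsum (g : τ → ℝ) : ∑ t : {t // 0 < α t}, α t * g t = ∑ t, α t * g t := by
    rw [← Finset.sum_filter_of_ne (p := fun t => 0 < α t) fun t _ ht =>
      hpos (left_ne_zero_of_mul ht)]
    exact (Finset.sum_subtype _ (by simp) fun t => α t * g t).symm
  have hprod (g : τ → ℝ) : ∏ t : {t // 0 < α t}, g t ^ α t = ∏ t, g t ^ α t := by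
    rw [← Finset.prod_filter_of_ne (p := fun t => 0 < α t) fun t _ ht => hpos fun h0 =>
      ht (by rw [h0, Real.rpow_zero])]
    exact (Finset.prod_subtype _ (by simp) fun t => g t ^ α t).symm
  rw [← hprod]
  exact prod_card_edgeTables_rpow_le_of_pos (fun t : {t // 0 < α t} => t.2)
    (by simpa only [mul_one, hα1] using hsum fun _ => 1) fun s => (hβ s).trans (hsum _).symm

end IntegralRepresentation

section BipartiteGraph

variable {m n : ℕ}

/-- The row or column at the end of an edge, where each cell `c` of an `m × n` matrix is joined by
`inl c` to its row and by `inr c` to its column. -/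
def lineNode (m n : ℕ) : (Fin m × Fin n) ⊕ (Fin m × Fin n) → Fin m ⊕ Fin n :=
  Sum.map Prod.fst Prod.snd

/-- The cell at the end of an edge. -/
def cellNode (m n : ℕ) : (Fin m × Fin n) ⊕ (Fin m × Fin n) → Fin m × Fin n :=
  Sum.elim id id

theorem mem_fiberTables_lineNode {β : Fin m ⊕ Fin n → ℕ}
    {a : (Fin m × Fin n) ⊕ (Fin m × Fin n) → ℕ} :
    a ∈ fiberTables (lineNode m n) β ↔
      (∀ i, ∑ j, a (.inl (i, j)) = β (.inl i)) ∧ ∀ j, ∑ i, a (.inr (i, j)) = β (.inr j) := by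
  have hrow (i : Fin m) : ({q | lineNode m n q = .inl i} : Finset _) =
      Finset.univ.map
        ⟨fun j => .inl (i, j), Sum.inl_injective.comp (Prod.mk_right_injective i)⟩ := by
    ext (c | c) <;> rw [Finset.mem_filter_univ] <;> simp [lineNode, Prod.ext_iff, eq_comm]
  have hcol (j : Fin n) : ({q | lineNode m n q = .inr j} : Finset _) =
      Finset.univ.map
        ⟨fun i => .inr (i, j), Sum.inr_injective.comp (Prod.mk_left_injective j)⟩ := by
    ext (c | c) <;> rw [Finset.mem_filter_univ] <;> simp [lineNode, Prod.ext_iff, eq_comm]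
  simp only [mem_fiberTables, Sum.forall, hrow, hcol, Finset.sum_map, Function.Embedding.coeFn_mk]

theorem mem_fiberTables_cellNode {k : Fin m × Fin n → ℕ}
    {a : (Fin m × Fin n) ⊕ (Fin m × Fin n) → ℕ} :
    a ∈ fiberTables (cellNode m n) k ↔ ∀ c, a (.inl c) + a (.inr c) = k c := by
  have hcell (c : Fin m × Fin n) :
      ({q | cellNode m n q = c} : Finset _) = {.inl c, .inr c} := by
    ext (c' | c') <;> rw [Finset.mem_filter_univ] <;> simp [cellNode]
  simp only [mem_fiberTables, hcell, Finset.sum_pair Sum.inl_ne_inr]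

theorem numTables_eq_card_edgeTables (K : Matrix (Fin m) (Fin n) ℕ) (R : Fin m → ℕ)
    {C : Fin n → ℕ} (hC : ∀ j, C j ≤ ∑ i, K i j) :
    numTables K R C = (edgeTables (lineNode m n) (cellNode m n) (Sum.elim R (compl K C))
      (Function.uncurry K)).card := by
  rw [numTables, ← Set.ncard_coe_finset]
  refine Set.ncard_congr
    (fun A _ => Sum.elim (Function.uncurry A) (Function.uncurry K - Function.uncurry A))
    ?_ ?_ ?_
  · rintro A ⟨hAR, hAC, hAK⟩
    rw [Finset.mem_coe, mem_edgeTables, mem_fiberTables_lineNode, mem_fiberTables_cellNode]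
    refine ⟨⟨hAR, fun j => ?_⟩, fun c => Nat.add_sub_cancel' (hAK _ _)⟩
    simp only [Sum.elim_inr, compl, ← hAC j]
    exact Finset.sum_tsub_distrib _ fun i _ => hAK i j
  · intro A B _ _ hAB
    ext i j
    exact congrFun hAB (Sum.inl (i, j))
  · intro a ha
    rw [Finset.mem_coe, mem_edgeTables, mem_fiberTables_lineNode, mem_fiberTables_cellNode] at ha
    obtain ⟨⟨hrow, hcol⟩, hcell⟩ := ha
    have hcell' (i : Fin m) (j : Fin n) : a (.inl (i, j)) + a (.inr (i, j)) = K i j := hcell (i, j)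
    refine ⟨fun i j => a (.inl (i, j)), ⟨hrow, fun j => ?_, fun i j => ?_⟩, ?_⟩
    · have hsum : ∑ i, a (.inl (i, j)) + (∑ i, K i j - C j) = ∑ i, K i j := by
        rw [← compl, ← Sum.elim_inr R (compl K C), ← hcol, ← Finset.sum_add_distrib]
        exact Finset.sum_congr rfl fun i _ => hcell' i j
      change ∑ i, a (.inl (i, j)) = C j
      have := hC j
      omega
    · exact (Nat.le_add_right _ _).trans_eq (hcell' i j)
    · funext q
      rcases q with c | c
      · rfl
      · exact (Nat.eq_sub_of_add_eq' (hcell c)).symm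

theorem vecOmega_elim (R : Fin m → ℕ) (C : Fin n → ℕ) :
    vecOmega (Sum.elim R C) = vecOmega R * vecOmega C :=
  Fintype.prod_sum_type _

theorem vecOmega_uncurry (K : Matrix (Fin m) (Fin n) ℕ) :
    vecOmega (Function.uncurry K) = matOmega K :=
  Fintype.prod_prod_type _

theorem sum_uncurry (K : Matrix (Fin m) (Fin n) ℕ) : ∑ c, Function.uncurry K c = matSum K :=
  Fintype.sum_prod_type _

theorem weighted_mean_le {τ : Type*} [Fintype τ] {α : τ → ℝ} (hα : ∀ t, 0 ≤ α t)
    (hα1 : ∑ t, α t = 1) {c : τ → ℕ} {s C : ℕ} (hC : (C : ℝ) = ∑ t, α t * c t)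
    (hc : ∀ t, c t ≤ s) : C ≤ s := by
  have hcast : (C : ℝ) ≤ s := calc
    (C : ℝ) = ∑ t, α t * c t := hC
    _ ≤ ∑ t, α t * s := Finset.sum_le_sum fun t _ =>
        mul_le_mul_of_nonneg_left (Nat.cast_le.mpr (hc t)) (hα t)
    _ = s := by rw [← Finset.sum_mul, hα1, one_mul]
  exact_mod_cast hcast

theorem compl_eq_weighted_mean {τ : Type*} [Fintype τ] {α : τ → ℝ} (hα : ∀ t, 0 ≤ α t)
    (hα1 : ∑ t, α t = 1) {K : Matrix (Fin m) (Fin n) ℕ} {c : τ → Fin n → ℕ} {C : Fin n → ℕ}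
    (hC : ∀ j, (C j : ℝ) = ∑ t, α t * c t j) (hK : ∀ t j, c t j ≤ ∑ i, K i j) (j : Fin n) :
    (compl K C j : ℝ) = ∑ t, α t * compl K (c t) j := by
  have hCK : C j ≤ ∑ i, K i j := weighted_mean_le hα hα1 (hC j) (hK · j)
  simp only [compl, Nat.cast_sub hCK, fun t => Nat.cast_sub (R := ℝ) (hK t j), mul_sub,
    Finset.sum_sub_distrib, ← Finset.sum_mul, hα1, one_mul, hC]

end BipartiteGraph

end BoundedTables

open BoundedTables in
theorem theorem1_general {m n : ℕ} {τ : Type*} [Fintype τ]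
    (α : τ → ℝ) (hα : ∀ t, 0 ≤ α t) (hα1 : ∑ t, α t = 1)
    (Rt : τ → Fin m → ℕ) (Ct : τ → Fin n → ℕ) (K : Matrix (Fin m) (Fin n) ℕ)
    (R : Fin m → ℕ) (hR : ∀ i, (R i : ℝ) = ∑ t, α t * (Rt t i : ℝ))
    (C : Fin n → ℕ) (hC : ∀ j, (C j : ℝ) = ∑ t, α t * (Ct t j : ℝ))
    (hK : ∀ t j, Ct t j ≤ ∑ i, K i j) :
    omega (matSum K) * (numTables K R C : ℝ) /
        (vecOmega R * vecOmega (compl K C) * matOmega K) ≥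
      ∏ t, ((numTables K (Rt t) (Ct t) : ℝ) /
        min (vecOmega (Rt t) * vecOmega (compl K (Ct t))) (matOmega K)) ^ (α t) := by
  have hCK (j : Fin n) : C j ≤ ∑ i, K i j := weighted_mean_le hα hα1 (hC j) (hK · j)
  have hmean : ∀ s, ((Sum.elim R (compl K C) s : ℕ) : ℝ) =
      ∑ t, α t * (Sum.elim (Rt t) (compl K (Ct t)) s : ℕ)
    | .inl i => hR i
    | .inr j => compl_eq_weighted_mean hα hα1 hC hK j
  have hedge := prod_card_edgeTables_rpow_le (ℓ := lineNode m n) (κ := cellNode m n)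
    (k := Function.uncurry K) hα hα1 hmean
  simpa only [← numTables_eq_card_edgeTables K _ (hK _), ← numTables_eq_card_edgeTables K _ hCK,
    vecOmega_elim, vecOmega_uncurry, sum_uncurry] using hedge

theorem theorem1 {m n p : ℕ} (N : ℕ)
    (α : Fin p → ℝ) (hα : ∀ t, 0 ≤ α t) (hα1 : ∑ t, α t = 1)
    (Rt : Fin p → Fin m → ℕ) (Ct : Fin p → Fin n → ℕ)
    (hRt : ∀ t, ∑ i, Rt t i = N) (hCt : ∀ t, ∑ j, Ct t j = N)
    (K : Matrix (Fin m) (Fin n) ℕ)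
    (R : Fin m → ℕ) (hR : ∀ i, (R i : ℝ) = ∑ t, α t * (Rt t i : ℝ))
    (C : Fin n → ℕ) (hC : ∀ j, (C j : ℝ) = ∑ t, α t * (Ct t j : ℝ))
    (hK : ∀ t j, Ct t j ≤ ∑ i, K i j) :
    BoundedTables.omega (BoundedTables.matSum K) * (BoundedTables.numTables K R C : ℝ) /
        (BoundedTables.vecOmega R * BoundedTables.vecOmega (BoundedTables.compl K C) *
          BoundedTables.matOmega K) ≥
      ∏ t, ((BoundedTables.numTables K (Rt t) (Ct t) : ℝ) /
        min (BoundedTables.vecOmega (Rt t) *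
            BoundedTables.vecOmega (BoundedTables.compl K (Ct t)))
          (BoundedTables.matOmega K)) ^ (α t) :=
  theorem1_general α hα hα1 Rt Ct K R hR C hC hK
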